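/- Let $\Omega\subset\mathbb{R}^4$ be a bounded domain with smooth boundary which is strictly starshaped about the origin, i.e. $\Omega$ is starshaped about $0$ and, for some $c>0$, $x\cdot\nu(x)\ge c$ for every $x\in\partial\Omega$, where $\nu$ is the outward unit normal. Let $p>1$ and $0<q<1$, and put $$g(s)=\begin{cases}|s|^{p-1}s, & |s|<1,\\ |s|^{q-1}s, & |s|\ge 1.\end{cases}$$ Then there is a constant $\lambda_0=\lambda_0(q,p,\Omega)>0$ such that the following holds. If $\lambda\in\mathbb{R}$ is such that the problem $$-\Delta u=\lambda g(u)+|u|^{2}u\ \text{ in }\Omega,\qquad u>0\ \text{ in }\Omega,\qquad u=0\ \text{ on }\partial\Omega$$ (with critical exponent $2^*=4$, so that $2^*-2=2$) has a classical solution $u\in C^2(\Omega)\cap C(\overline\Omega)$, then $|\lambda|\ge\lambda_0$; and if moreover $\lambda\ge 0$ or $p\le 3$, then $\lambda\ge\lambda_0$. -/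

import Mathlib

open Set Topology
open scoped ContDiff

noncomputable section

/-- `ρ` is a smooth defining function of `Ω` near the boundary point `x`: it is smooth, its
gradient does not vanish at `x`, and near `x` the set `Ω` is exactly `{ρ < 0}`. -/
def IsLocalDefiningFunction {N : ℕ} (Ω : Set (EuclideanSpace ℝ (Fin N)))
    (x : EuclideanSpace ℝ (Fin N)) (ρ : EuclideanSpace ℝ (Fin N) → ℝ) : Prop :=
  ContDiff ℝ ∞ ρ ∧ gradient ρ x ≠ 0 ∧ ∃ U ∈ 𝓝 x, ∀ y ∈ U, y ∈ Ω ↔ ρ y < 0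

/-- A bounded domain (nonempty, connected, open) with smooth boundary. -/
structure IsSmoothBoundedDomain {N : ℕ} (Ω : Set (EuclideanSpace ℝ (Fin N))) : Prop where
  isOpen : IsOpen Ω
  isConnected : IsConnected Ω
  isBounded : Bornology.IsBounded Ω
  smooth_boundary : ∀ x ∈ frontier Ω, ∃ ρ, IsLocalDefiningFunction Ω x ρ

/-- `ν` is the outward unit normal to the boundary of `Ω` at `x`: the normalized gradient of a
local defining function (it does not depend on the choice of that function). -/
def IsOutwardUnitNormal {N : ℕ} (Ω : Set (EuclideanSpace ℝ (Fin N)))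
    (x ν : EuclideanSpace ℝ (Fin N)) : Prop :=
  ∃ ρ, IsLocalDefiningFunction Ω x ρ ∧ ν = ‖gradient ρ x‖⁻¹ • gradient ρ x

/-- `Ω` is strictly starshaped about the origin: it is starshaped about the origin, and
`x · ν` is bounded below by a positive constant on the boundary. -/
def IsStrictlyStarshaped {N : ℕ} (Ω : Set (EuclideanSpace ℝ (Fin N))) : Prop :=
  StarConvex ℝ 0 Ω ∧
    ∃ c : ℝ, 0 < c ∧ ∀ x ∈ frontier Ω, ∀ ν, IsOutwardUnitNormal Ω x ν → c ≤ inner ℝ x ν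

/-- The critical Sobolev exponent `2* = 2N / (N - 2)` (for `N ≥ 3`). -/
def criticalExponent (N : ℕ) : ℝ := 2 * (N : ℝ) / ((N : ℝ) - 2)

/-- `u` is a (classical) solution of
`-Δu = lam * g(u) + |u|^(2* - 2) u` in `Ω`, `u > 0` in `Ω`, `u = 0` on the boundary of `Ω`:
`u` is twice continuously differentiable in `Ω` and continuous on the closure of `Ω`. Values of
`u` outside the closure play no role. -/
structure IsPositiveSolution {N : ℕ} (Ω : Set (EuclideanSpace ℝ (Fin N))) (g : ℝ → ℝ) (lam : ℝ)
    (u : EuclideanSpace ℝ (Fin N) → ℝ) : Prop where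
  contDiffOn : ContDiffOn ℝ 2 u Ω
  continuousOn : ContinuousOn u (closure Ω)
  equation : ∀ x ∈ Ω,
    -(Laplacian.laplacian u x) = lam * g (u x) + |u x| ^ (criticalExponent N - 2) * u x
  pos : ∀ x ∈ Ω, 0 < u x
  boundary : ∀ x ∈ frontier Ω, u x = 0

/-- The perturbation `|s|^(p-1) s` for `|s| < 1` and `|s|^(q-1) s` for `|s| ≥ 1`. -/
def perturbation (p q : ℝ) (s : ℝ) : ℝ :=
  if |s| < 1 then |s| ^ (p - 1) * s else |s| ^ (q - 1) * s

end

open MeasureTheory Filter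

/-! Write f(s) = λ g(s) + s³ and let F, G be the primitives of f, g vanishing at 0. If u is regular
up to the boundary, the Pohozaev identity in dimension 4 says that P = 4∫F(u) - ∫f(u)u is half the
integral of (x·ν)(∂u/∂ν)² over the boundary. Since ∫f(u) is minus the flux of ∇u, strict
starshapedness and Cauchy–Schwarz give κ(∫f(u))² ≤ P (`exists_pohozaev_const`). The critical power
cancels in P, leaving P = λ∫H(u) with H(s) = 4G(s) - s g(s).

For the opposite bound, the Sobolev inequality applied to truncations of u gives |{u ≥ k}| ≤
C‖f(u)‖₁²/k² (`exists_weak_type_const`). The layer cake formula then yields ∫G(u) ≤ CW‖f(u)‖₁²,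
where W = ∫g(t)/t² dt over (0,∞) is finite exactly because p > 1 and q < 1. Moreover |H| ≤ (p+5)G on
[0,∞). If f ≥ 0 on [0,∞), then ‖f(u)‖₁ = ∫f(u), both sides are quadratic in this positive number,
and dividing by its square bounds |λ| from below.

Nonnegativity of f holds for λ ≥ 0, and also for p > 3 and -1 < λ < 0 because then g(s) ≤ s³; λ ≤ -1
needs no argument. If λ < 0 and p ≤ 3, then H ≥ 0, so Pohozaev forces ∫f(u) = 0 and H(u) = 0. This
leaves only p = 3 with u ≤ 1, where f(u) = (λ+1)u³ has zero integral only if it vanishes, which is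
impossible.

A solution is only continuous up to the boundary, so ∂u/∂ν is not available. The boundary integral
is replaced by the Dirichlet energy of the thin layer {x : rx ∉ Ω}, divided by r - 1, as r ↓ 1. That
energy is estimated by comparing u with its dilation u(r·), and the flux is recovered by testing the
equation with a cut-off that varies only in the layer. -/

/-- Four-dimensional Euclidean space. -/
abbrev E4 := EuclideanSpace ℝ (Fin 4)

/-! ### Scalar truncations -/

/-- Squaring removes the corner of the positive part; both truncations below are built on this. -/
theorem hasDerivAt_max_zero_sq (s : ℝ) :
    HasDerivAt (fun s : ℝ => (max s 0) ^ 2) (2 * max s 0) s := by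
  rcases lt_trichotomy s 0 with h | rfl | h
  · have : (fun s : ℝ => (max s 0) ^ 2) =ᶠ[𝓝 s] fun _ => 0 := by
      filter_upwards [gt_mem_nhds h] with t ht
      simp [max_eq_right ht.le]
    rw [max_eq_right h.le]
    simpa using (hasDerivAt_const s (0 : ℝ)).congr_of_eventuallyEq this
  · rw [hasDerivAt_iff_isLittleO_nhds_zero]
    simp only [max_self, zero_add, mul_zero, smul_eq_mul, sub_zero, ne_eq, OfNat.ofNat_ne_zero,
      not_false_eq_true, zero_pow]
    refine Asymptotics.IsBigO.trans_isLittleO (g := fun h : ℝ => h ^ 2) ?_ ?_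
    · refine Asymptotics.IsBigO.of_bound 1 (Eventually.of_forall fun h => ?_)
      rw [one_mul, norm_pow, norm_pow]
      gcongr
      rw [Real.norm_eq_abs, Real.norm_eq_abs, abs_of_nonneg (le_max_right _ _)]
      exact max_le (le_abs_self _) (abs_nonneg _)
    · simpa using Asymptotics.isLittleO_pow_pow (𝕜 := ℝ) (m := 1) (n := 2) (by norm_num)
  · have : (fun s : ℝ => (max s 0) ^ 2) =ᶠ[𝓝 s] fun s => s ^ 2 := by
      filter_upwards [lt_mem_nhds h] with t ht
      simp [max_eq_left ht.le]
    rw [max_eq_left h.le]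
    simpa using (hasDerivAt_pow 2 s).congr_of_eventuallyEq this

/-- A `C¹` approximation of the identity on `[0, ∞)` which vanishes on `(-∞, ε]`. -/
noncomputable def softTrunc (ε s : ℝ) : ℝ := √((max (s - ε) 0) ^ 2 + ε ^ 2) - ε

/-- The derivative of `softTrunc`. -/
noncomputable def softTruncDeriv (ε s : ℝ) : ℝ :=
  max (s - ε) 0 / √((max (s - ε) 0) ^ 2 + ε ^ 2)

theorem hasDerivAt_softTrunc {ε : ℝ} (hε : 0 < ε) (s : ℝ) :
    HasDerivAt (softTrunc ε) (softTruncDeriv ε s) s := by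
  have h1 : HasDerivAt (fun s : ℝ => (max (s - ε) 0) ^ 2 + ε ^ 2) (2 * max (s - ε) 0) s := by
    have := (hasDerivAt_max_zero_sq (s - ε)).comp s ((hasDerivAt_id s).sub_const ε)
    simpa [Function.comp_def] using this.add_const (ε ^ 2)
  have h2 := (h1.sqrt (by positivity)).sub_const ε
  have h3 : softTruncDeriv ε s =
      2 * max (s - ε) 0 / (2 * √((max (s - ε) 0) ^ 2 + ε ^ 2)) := by
    unfold softTruncDeriv
    field_simp
  rw [h3]
  exact h2

theorem continuous_softTruncDeriv {ε : ℝ} (hε : 0 < ε) : Continuous (softTruncDeriv ε) := by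
  unfold softTruncDeriv
  refine Continuous.div (by fun_prop) (by fun_prop) fun s => ?_
  positivity

theorem softTruncDeriv_nonneg (ε s : ℝ) : 0 ≤ softTruncDeriv ε s := by
  unfold softTruncDeriv
  positivity

theorem softTruncDeriv_le_one (ε s : ℝ) : softTruncDeriv ε s ≤ 1 := by
  unfold softTruncDeriv
  refine div_le_one_of_le₀ ?_ (Real.sqrt_nonneg _)
  exact Real.le_sqrt_of_sq_le (by nlinarith [sq_nonneg ε])

theorem softTrunc_of_le {ε s : ℝ} (hε : 0 < ε) (hs : s ≤ ε) : softTrunc ε s = 0 := by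
  unfold softTrunc
  rw [max_eq_right (by linarith)]
  simp [Real.sqrt_sq hε.le]

theorem abs_softTrunc_sub_le {ε s : ℝ} (hε : 0 < ε) (hs : 0 ≤ s) :
    |softTrunc ε s - s| ≤ 2 * ε := by
  unfold softTrunc
  have h0 := le_max_right (s - ε) 0
  have h1 := le_max_left (s - ε) 0
  have h2 : max (s - ε) 0 ≤ s := max_le (by linarith) hs
  have h3 : max (s - ε) 0 ≤ √((max (s - ε) 0) ^ 2 + ε ^ 2) :=
    Real.le_sqrt_of_sq_le (by nlinarith)
  have h4 : √((max (s - ε) 0) ^ 2 + ε ^ 2) ≤ max (s - ε) 0 + ε :=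
    Real.sqrt_le_iff.2 ⟨by linarith, by nlinarith⟩
  rw [abs_le]
  constructor <;> linarith

theorem tendsto_softTruncDeriv {s : ℝ} (hs : 0 < s) {ε : ℕ → ℝ} (hε : Tendsto ε atTop (𝓝 0)) :
    Tendsto (fun n => softTruncDeriv (ε n) s) atTop (𝓝 1) := by
  have h1 : Tendsto (fun n => max (s - ε n) 0) atTop (𝓝 s) := by
    have := (tendsto_const_nhds (x := s)).sub hε
    simpa [max_eq_left hs.le] using this.max (tendsto_const_nhds (x := (0 : ℝ)))
  have h2 : Tendsto (fun n => √((max (s - ε n) 0) ^ 2 + ε n ^ 2)) atTop (𝓝 s) := by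
    have := ((h1.pow 2).add (hε.pow 2)).sqrt
    simpa [Real.sqrt_sq hs.le] using this
  have h3 := h1.div h2 hs.ne'
  rw [div_self hs.ne'] at h3
  exact h3

/-- A `C¹` truncation at height `k` which vanishes on `(-∞, k / 2]`. -/
noncomputable def softCap (k s : ℝ) : ℝ :=
  k * ((max (s / k - 1 / 2) 0) ^ 2 / (1 + (max (s / k - 1 / 2) 0) ^ 2))

/-- The derivative of `softCap`. -/
noncomputable def softCapDeriv (k s : ℝ) : ℝ :=
  2 * max (s / k - 1 / 2) 0 / (1 + (max (s / k - 1 / 2) 0) ^ 2) ^ 2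

theorem hasDerivAt_softCap {k : ℝ} (hk : 0 < k) (s : ℝ) :
    HasDerivAt (softCap k) (softCapDeriv k s) s := by
  have h1 : HasDerivAt (fun s : ℝ => (max (s / k - 1 / 2) 0) ^ 2)
      (2 * max (s / k - 1 / 2) 0 * (1 / k)) s := by
    have := (hasDerivAt_max_zero_sq (s / k - 1 / 2)).comp s
      (((hasDerivAt_id s).div_const k).sub_const (1 / 2))
    simpa [Function.comp_def] using this
  have h2 := (h1.div (h1.const_add 1) (by positivity)).const_mul k
  refine h2.congr_deriv ?_
  unfold softCapDeriv
  field_simp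
  ring

theorem continuous_softCapDeriv (k : ℝ) : Continuous (softCapDeriv k) := by
  unfold softCapDeriv
  refine Continuous.div (by fun_prop) (by fun_prop) fun s => ?_
  positivity

theorem softCapDeriv_nonneg (k s : ℝ) : 0 ≤ softCapDeriv k s := by
  unfold softCapDeriv
  positivity

theorem softCapDeriv_le_one (k s : ℝ) : softCapDeriv k s ≤ 1 := by
  unfold softCapDeriv
  refine div_le_one_of_le₀ ?_ (by positivity)
  nlinarith [sq_nonneg (max (s / k - 1 / 2) 0 - 1), sq_nonneg (max (s / k - 1 / 2) 0),
    sq_nonneg ((max (s / k - 1 / 2) 0) ^ 2)]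

theorem softCap_of_le {k s : ℝ} (hk : 0 < k) (hs : s ≤ k / 2) : softCap k s = 0 := by
  unfold softCap
  have : s / k ≤ 1 / 2 := by
    rw [div_le_iff₀ hk]
    linarith
  rw [max_eq_right (by linarith)]
  simp

theorem softCap_nonneg {k : ℝ} (hk : 0 < k) (s : ℝ) : 0 ≤ softCap k s := by
  unfold softCap
  positivity

theorem softCap_le {k : ℝ} (hk : 0 < k) (s : ℝ) : softCap k s ≤ k := by
  unfold softCap
  refine mul_le_of_le_one_right hk.le (div_le_one_of_le₀ ?_ (by positivity))
  linarith

theorem le_softCap {k s : ℝ} (hk : 0 < k) (hs : k ≤ s) : k / 5 ≤ softCap k s := by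
  unfold softCap
  have h1 : 1 ≤ s / k := by rwa [le_div_iff₀ hk, one_mul]
  -- The map t ↦ t²/(1+t²) is increasing on [0,∞) and equals 1/5 at t = 1/2, which gives the
  -- constant in `k / 5`.
  have h2 : (1 : ℝ) / 2 ≤ max (s / k - 1 / 2) 0 := le_trans (by linarith) (le_max_left _ _)
  rw [div_eq_mul_inv]
  refine mul_le_mul_of_nonneg_left ?_ hk.le
  rw [le_div_iff₀ (by positivity)]
  nlinarith

/-! ### Solutions extended by zero -/

/-- A positive classical solution of `-Δu = f(u)` in a bounded open set `Ω`, with zero boundary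
values and extended by zero to the whole space. -/
structure IsExtendedSolution (Ω : Set E4) (f : ℝ → ℝ) (u : E4 → ℝ) : Prop where
  isOpen : IsOpen Ω
  isBounded : Bornology.IsBounded Ω
  continuous_rhs : Continuous f
  rhs_zero : f 0 = 0
  continuous : Continuous u
  eq_zero : ∀ x, x ∉ Ω → u x = 0
  pos : ∀ x ∈ Ω, 0 < u x
  contDiffOn : ContDiffOn ℝ 2 u Ω
  equation : ∀ x ∈ Ω, Laplacian.laplacian u x = -f (u x)

/-- The gradient of `u`, set to be zero off `Ω`. -/
noncomputable def innerGradient (Ω : Set E4) (u : E4 → ℝ) : E4 → E4 :=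
  Ω.indicator (gradient u)

namespace IsExtendedSolution

variable {Ω : Set E4} {f : ℝ → ℝ} {u : E4 → ℝ}

theorem nonneg (h : IsExtendedSolution Ω f u) (x : E4) : 0 ≤ u x := by
  by_cases hx : x ∈ Ω
  · exact (h.pos x hx).le
  · exact (h.eq_zero x hx).ge

theorem superlevel_subset (h : IsExtendedSolution Ω f u) {ε : ℝ} (hε : 0 < ε) :
    {x | ε ≤ u x} ⊆ Ω := by
  intro x hx
  by_contra hxΩ
  have := h.eq_zero x hxΩ
  exact absurd (this ▸ hx : ε ≤ 0) (not_le.2 hε)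

theorem isCompact_superlevel (h : IsExtendedSolution Ω f u) {ε : ℝ} (hε : 0 < ε) :
    IsCompact {x | ε ≤ u x} :=
  Metric.isCompact_of_isClosed_isBounded (isClosed_le continuous_const h.continuous)
    (h.isBounded.subset (h.superlevel_subset hε))

theorem hasCompactSupport (h : IsExtendedSolution Ω f u) : HasCompactSupport u := by
  refine HasCompactSupport.intro h.isBounded.isCompact_closure fun x hx => ?_
  exact h.eq_zero x fun hxΩ => hx (subset_closure hxΩ)

theorem differentiableAt (h : IsExtendedSolution Ω f u) {x : E4} (hx : x ∈ Ω) :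
    DifferentiableAt ℝ u x :=
  (h.contDiffOn.contDiffAt (h.isOpen.mem_nhds hx)).differentiableAt (by norm_num)

theorem hasGradientAt (h : IsExtendedSolution Ω f u) {x : E4} (hx : x ∈ Ω) :
    HasGradientAt u (innerGradient Ω u x) x := by
  rw [innerGradient, indicator_of_mem hx]
  exact (h.differentiableAt hx).hasGradientAt

theorem continuousOn_gradient (h : IsExtendedSolution Ω f u) : ContinuousOn (gradient u) Ω := by
  have h1 : ContinuousOn (fderiv ℝ u) Ω :=
    h.contDiffOn.continuousOn_fderiv_of_isOpen h.isOpen (by norm_num)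
  exact (InnerProductSpace.toDual ℝ E4).symm.continuous.comp_continuousOn h1

theorem measurable_innerGradient (h : IsExtendedSolution Ω f u) :
    Measurable (innerGradient Ω u) := by
  classical
  have := h.continuousOn_gradient.measurable_piecewise (g := fun _ => (0 : E4))
    continuousOn_const h.isOpen.measurableSet
  rwa [show Ω.piecewise (gradient u) (fun _ => (0 : E4)) = innerGradient Ω u from
    piecewise_eq_indicator] at this

end IsExtendedSolution

/-- A `C¹` function with compact support contained in `Ω`. -/
structure IsTestFunction (Ω : Set E4) (φ : E4 → ℝ) : Prop where
  contDiff : ContDiff ℝ 1 φ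
  hasCompactSupport : HasCompactSupport φ
  tsupport_subset : tsupport φ ⊆ Ω

namespace IsTestFunction

variable {Ω : Set E4} {φ : E4 → ℝ}

theorem continuous_gradient (hφ : IsTestFunction Ω φ) : Continuous (gradient φ) :=
  (InnerProductSpace.toDual ℝ E4).symm.continuous.comp
    (hφ.contDiff.continuous_fderiv (by norm_num))

theorem gradient_eq_zero {x : E4} (hx : x ∉ tsupport φ) : gradient φ x = 0 := by
  have : fderiv ℝ φ x = 0 := by
    by_contra h
    exact hx (support_fderiv_subset ℝ h)
  simp [gradient, this]

theorem hasCompactSupport_gradient (hφ : IsTestFunction Ω φ) :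
    HasCompactSupport (gradient φ) :=
  HasCompactSupport.intro hφ.hasCompactSupport fun _ hx => gradient_eq_zero hx

end IsTestFunction

namespace IsExtendedSolution

variable {Ω : Set E4} {f : ℝ → ℝ} {u : E4 → ℝ}

/-- `C¹` functions of `u` vanishing near `0` are test functions. -/
theorem isTestFunction_comp (h : IsExtendedSolution Ω f u) {ψ ψ' : ℝ → ℝ} {ε : ℝ} (hε : 0 < ε)
    (hψ : ∀ s, HasDerivAt ψ (ψ' s) s) (hψ' : Continuous ψ') (hz : ∀ s ≤ ε, ψ s = 0) :
    IsTestFunction Ω (fun x => ψ (u x)) ∧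
      ∀ x, gradient (fun x => ψ (u x)) x = ψ' (u x) • innerGradient Ω u x := by
  have hsupp : tsupport (fun x => ψ (u x)) ⊆ {x | ε ≤ u x} := by
    refine closure_minimal (fun x hx => ?_) (isClosed_le continuous_const h.continuous)
    by_contra hlt
    exact hx (hz _ (not_le.1 hlt).le)
  have hψc : ContDiff ℝ 1 ψ := by
    rw [contDiff_one_iff_deriv]
    refine ⟨fun s => (hψ s).differentiableAt, ?_⟩
    rwa [show deriv ψ = ψ' from funext fun s => (hψ s).deriv]
  refine ⟨⟨?_, ?_, hsupp.trans (h.superlevel_subset hε)⟩, fun x => ?_⟩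
  · rw [contDiff_iff_contDiffAt]
    intro x
    by_cases hx : x ∈ Ω
    · exact hψc.contDiffAt.comp x
        ((h.contDiffOn.contDiffAt (h.isOpen.mem_nhds hx)).of_le (by norm_num))
    · have : x ∉ tsupport (fun x => ψ (u x)) := fun hx' => hx (h.superlevel_subset hε (hsupp hx'))
      rw [notMem_tsupport_iff_eventuallyEq] at this
      exact contDiffAt_const.congr_of_eventuallyEq this
  · exact (h.isCompact_superlevel hε).of_isClosed_subset (isClosed_tsupport _) hsupp
  · by_cases hx : x ∈ Ω
    · have h1 := (h.hasGradientAt hx).hasFDerivAt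
      have h2 := (hψ (u x)).comp_hasFDerivAt x h1
      have h3 : HasGradientAt (fun x => ψ (u x)) (ψ' (u x) • innerGradient Ω u x) x := by
        rw [hasGradientAt_iff_hasFDerivAt]
        simpa [Function.comp_def] using h2
      exact h3.gradient
    · rw [innerGradient, indicator_of_notMem hx, smul_zero]
      exact IsTestFunction.gradient_eq_zero
        fun hx' => hx (h.superlevel_subset hε (hsupp hx'))

theorem _root_.integrable_mul_of_tsupport_subset {φ g : E4 → ℝ} (hφ : HasCompactSupport φ)
    (hφc : Continuous φ) (hsub : tsupport φ ⊆ Ω) (hΩ : IsOpen Ω) (hg : ContinuousOn g Ω) :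
    Integrable (fun x => φ x * g x) := by
  refine Continuous.integrable_of_hasCompactSupport ?_ hφ.mul_right
  refine continuous_of_tsupport fun x hx => ?_
  have hxΩ := hsub (tsupport_mul_subset_left hx)
  exact hφc.continuousAt.mul (hg.continuousAt (hΩ.mem_nhds hxΩ))

/-- Weak formulation of the equation. -/
theorem integral_inner_gradient (h : IsExtendedSolution Ω f u) {φ : E4 → ℝ}
    (hφ : IsTestFunction Ω φ) :
    ∫ x, inner ℝ (innerGradient Ω u x) (gradient φ x) = ∫ x, f (u x) * φ x := by
  set b := EuclideanSpace.basisFun (Fin 4) ℝ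
  have hφd : Continuous (fderiv ℝ φ) := hφ.contDiff.continuous_fderiv (by norm_num)
  have hfd : ContDiffOn ℝ 1 (fderiv ℝ u) Ω := h.contDiffOn.fderiv_of_isOpen h.isOpen (by norm_num)
  have hfde (e : E4) : ContDiffOn ℝ 1 (fun x => fderiv ℝ u x e) Ω :=
    hfd.clm_apply contDiffOn_const
  have hsub' (e : E4) : tsupport (fun x => fderiv ℝ φ x e) ⊆ tsupport φ :=
    tsupport_fderiv_apply_subset ℝ e
  have hI1 (e : E4) : Integrable (fun x => fderiv ℝ φ x e * fderiv ℝ u x e) :=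
    integrable_mul_of_tsupport_subset (hφ.hasCompactSupport.fderiv_apply ℝ e)
      (hφd.clm_apply continuous_const) ((hsub' e).trans hφ.tsupport_subset) h.isOpen
      (hfde e).continuousOn
  have hI2 (e : E4) : Integrable (fun x => φ x * fderiv ℝ (fun x => fderiv ℝ u x e) x e) :=
    integrable_mul_of_tsupport_subset hφ.hasCompactSupport hφ.contDiff.continuous hφ.tsupport_subset
      h.isOpen (((hfde e).continuousOn_fderiv_of_isOpen h.isOpen (by norm_num)).clm_apply
        continuousOn_const)
  -- Integration by parts takes place inside the support of φ, so no regularity of u at the boundary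
  -- is needed.
  have key (e : E4) : ∫ x, φ x * fderiv ℝ (fun x => fderiv ℝ u x e) x e =
      -∫ x, fderiv ℝ φ x e * fderiv ℝ u x e := by
    refine integral_mul_fderiv_eq_neg_fderiv_mul_of_integrable (hI1 e) (hI2 e) ?_ ?_ ?_
    · exact integrable_mul_of_tsupport_subset hφ.hasCompactSupport hφ.contDiff.continuous
        hφ.tsupport_subset h.isOpen (hfde e).continuousOn
    · exact fun x _ => (hφ.contDiff.differentiable (by norm_num)) x
    · exact fun x hx => ((hfde e).contDiffAt (h.isOpen.mem_nhds
        (hφ.tsupport_subset hx))).differentiableAt (by norm_num)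
  have e1 : ∀ x, inner ℝ (innerGradient Ω u x) (gradient φ x) =
      ∑ i, fderiv ℝ φ x (b i) * fderiv ℝ u x (b i) := by
    intro x
    by_cases hx : x ∈ Ω
    · rw [innerGradient, indicator_of_mem hx, ← b.sum_inner_mul_inner]
      refine Finset.sum_congr rfl fun i _ => ?_
      rw [inner_gradient_left, inner_gradient_right, mul_comm]
      simp
    · have hx' : x ∉ tsupport φ := fun h' => hx (hφ.tsupport_subset h')
      have : fderiv ℝ φ x = 0 := by
        by_contra h
        exact hx' (support_fderiv_subset ℝ h)
      rw [IsTestFunction.gradient_eq_zero hx', inner_zero_right]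
      simp [this]
  have e2 : ∀ x, f (u x) * φ x =
      -∑ i, φ x * fderiv ℝ (fun x => fderiv ℝ u x (b i)) x (b i) := by
    intro x
    by_cases hx : x ∈ Ω
    · have hL := h.equation x hx
      rw [InnerProductSpace.laplacian_eq_iteratedFDeriv_orthonormalBasis u b] at hL
      have : f (u x) = -∑ i, iteratedFDeriv ℝ 2 u x ![b i, b i] := by
        linarith
      rw [this, neg_mul, Finset.sum_mul]
      refine congrArg _ (Finset.sum_congr rfl fun i _ => ?_)
      have hd : DifferentiableAt ℝ (fderiv ℝ u) x :=
        (hfd.contDiffAt (h.isOpen.mem_nhds hx)).differentiableAt (by norm_num)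
      rw [iteratedFDeriv_two_apply, fderiv_clm_apply hd (differentiableAt_const _), mul_comm]
      simp
    · have : φ x = 0 := image_eq_zero_of_notMem_tsupport fun h' => hx (hφ.tsupport_subset h')
      simp [this]
  simp_rw [e1, e2]
  rw [integral_neg, integral_finsetSum _ fun i _ => hI1 _, integral_finsetSum _ fun i _ => hI2 _,
    ← Finset.sum_neg_distrib]
  exact Finset.sum_congr rfl fun i _ => by rw [key, neg_neg]

end IsExtendedSolution

/-! ### Sobolev, energy and weak-type bounds -/

/-- The critical Sobolev inequality in dimension four. -/
theorem exists_sobolev_const : ∃ S : ℝ, 0 ≤ S ∧ ∀ φ : E4 → ℝ, ContDiff ℝ 1 φ →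
    HasCompactSupport φ → ∫ x, φ x ^ 4 ≤ S * (∫ x, ‖gradient φ x‖ ^ 2) ^ 2 := by
  set C : NNReal := SNormLESNormFDerivOfEqConst ℝ (volume : Measure E4) (2 : NNReal)
  refine ⟨(C : ℝ) ^ 4, by positivity, fun φ hφ hc => ?_⟩
  have hfin : Module.finrank ℝ E4 = 4 := by simp
  have key := eLpNorm_le_eLpNorm_fderiv_of_eq (volume : Measure E4) hφ hc (p := 2) (p' := 4)
    (by norm_num) (by rw [hfin]; norm_num) (by rw [hfin]; norm_num)
  have hm1 : MemLp φ ((4 : NNReal) : ENNReal) volume := hφ.continuous.memLp_of_hasCompactSupport hc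
  have hm2 : MemLp (fderiv ℝ φ) ((2 : NNReal) : ENNReal) volume :=
    (hφ.continuous_fderiv (by norm_num)).memLp_of_hasCompactSupport (hc.fderiv ℝ)
  rw [hm1.eLpNorm_eq_integral_rpow_norm (by simp) (by simp),
    hm2.eLpNorm_eq_integral_rpow_norm (by simp) (by simp)] at key
  have e1 : ∫ x, ‖φ x‖ ^ ((4 : NNReal) : ENNReal).toReal = ∫ x, φ x ^ 4 := by
    refine integral_congr_ae (Eventually.of_forall fun x => ?_)
    simp only [ENNReal.coe_toReal]
    rw [show ((4 : NNReal) : ℝ) = ((4 : ℕ) : ℝ) by norm_num, Real.rpow_natCast, Real.norm_eq_abs,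
      Even.pow_abs (by decide)]
  have e2 : ∫ x, ‖fderiv ℝ φ x‖ ^ ((2 : NNReal) : ENNReal).toReal =
      ∫ x, ‖gradient φ x‖ ^ 2 := by
    refine integral_congr_ae (Eventually.of_forall fun x => ?_)
    simp only [ENNReal.coe_toReal]
    rw [show ((2 : NNReal) : ℝ) = ((2 : ℕ) : ℝ) by norm_num, Real.rpow_natCast, gradient,
      LinearIsometryEquiv.norm_map]
  rw [e1, e2] at key
  set A := ∫ x, φ x ^ 4
  set B := ∫ x, ‖gradient φ x‖ ^ 2
  have hA : 0 ≤ A := integral_nonneg fun x => by positivity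
  have hB : 0 ≤ B := integral_nonneg fun x => by positivity
  have key2 : A ^ ((4 : ℝ)⁻¹) ≤ C * B ^ ((2 : ℝ)⁻¹) := by
    have := ENNReal.toReal_mono (by finiteness) key
    rw [ENNReal.toReal_mul, ENNReal.toReal_ofReal (by positivity),
      ENNReal.toReal_ofReal (by positivity)] at this
    simpa [C] using this
  calc A = (A ^ ((4 : ℝ)⁻¹)) ^ 4 := by
        rw [← Real.rpow_natCast, ← Real.rpow_mul hA]; norm_num
    _ ≤ (C * B ^ ((2 : ℝ)⁻¹)) ^ 4 := by gcongr
    _ = (C : ℝ) ^ 4 * ((B ^ ((2 : ℝ)⁻¹)) ^ 2) ^ 2 := by ring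
    _ = (C : ℝ) ^ 4 * B ^ 2 := by
        rw [← Real.rpow_natCast (B ^ ((2 : ℝ)⁻¹)), ← Real.rpow_mul hB]; norm_num

namespace IsExtendedSolution

variable {Ω : Set E4} {f : ℝ → ℝ} {u : E4 → ℝ}

theorem integrable_comp (h : IsExtendedSolution Ω f u) {g : ℝ → ℝ} (hg : Continuous g)
    (hg0 : g 0 = 0) : Integrable fun x => g (u x) :=
  (hg.comp h.continuous).integrable_of_hasCompactSupport (h.hasCompactSupport.comp_left hg0)

theorem integrable_rhs_mul (h : IsExtendedSolution Ω f u) {φ : E4 → ℝ} (hφ : Continuous φ) :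
    Integrable fun x => f (u x) * φ x :=
  ((h.continuous_rhs.comp h.continuous).mul hφ).integrable_of_hasCompactSupport
    (h.hasCompactSupport.comp_left h.rhs_zero).mul_right

theorem integrable_inner (h : IsExtendedSolution Ω f u) {φ : E4 → ℝ} (hφ : IsTestFunction Ω φ) :
    Integrable fun x => inner ℝ (innerGradient Ω u x) (gradient φ x) := by
  have hc : HasCompactSupport fun x => inner ℝ (innerGradient Ω u x) (gradient φ x) := by
    refine HasCompactSupport.intro hφ.hasCompactSupport fun x hx => ?_
    rw [IsTestFunction.gradient_eq_zero hx, inner_zero_right]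
  refine Continuous.integrable_of_hasCompactSupport ?_ hc
  refine continuous_of_tsupport fun x hx => ?_
  have hx' : x ∈ Ω := by
    refine hφ.tsupport_subset (closure_minimal (fun y hy => ?_) (isClosed_tsupport φ) hx)
    by_contra hy'
    exact hy (by simp only [IsTestFunction.gradient_eq_zero hy', inner_zero_right])
  have h1 : ContinuousAt (innerGradient Ω u) x := by
    refine (h.continuousOn_gradient.continuousAt (h.isOpen.mem_nhds hx')).congr ?_
    filter_upwards [h.isOpen.mem_nhds hx'] with y hy
    rw [innerGradient, indicator_of_mem hy]
  exact h1.inner hφ.continuous_gradient.continuousAt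

/-- The equation tested with ψ(u), which is admissible because ψ vanishes near 0 and so ψ(u) has
compact support in Ω. -/
theorem integrable_deriv_mul_sq (h : IsExtendedSolution Ω f u) {ψ ψ' : ℝ → ℝ} {ε : ℝ}
    (hε : 0 < ε) (hψ : ∀ s, HasDerivAt ψ (ψ' s) s) (hψ' : Continuous ψ')
    (hz : ∀ s ≤ ε, ψ s = 0) :
    Integrable (fun x => ψ' (u x) * ‖innerGradient Ω u x‖ ^ 2) ∧
      ∫ x, ψ' (u x) * ‖innerGradient Ω u x‖ ^ 2 = ∫ x, f (u x) * ψ (u x) := by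
  obtain ⟨h1, h2⟩ := h.isTestFunction_comp hε hψ hψ' hz
  have h3 := h.integral_inner_gradient h1
  have h4 := h.integrable_inner h1
  simp only [h2, inner_smul_right, real_inner_self_eq_norm_sq] at h3 h4
  exact ⟨h4, h3⟩

theorem abs_integral_softTrunc_sub_le (h : IsExtendedSolution Ω f u) {ε : ℝ} (hε : 0 < ε)
    {T : E4 → E4} (hT : Continuous T) :
    |(∫ x, f (u x) * softTrunc ε (u (T x))) - ∫ x, f (u x) * u (T x)| ≤
      2 * ε * ∫ x, |f (u x)| := by
  have hc : Continuous (softTrunc ε) :=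
    continuous_iff_continuousAt.2 fun s => (hasDerivAt_softTrunc hε s).continuousAt
  rw [← integral_sub (h.integrable_rhs_mul (φ := fun x => softTrunc ε (u (T x)))
    (hc.comp (h.continuous.comp hT)))
    (h.integrable_rhs_mul (φ := fun x => u (T x)) (h.continuous.comp hT)),
    ← Real.norm_eq_abs, ← integral_const_mul]
  refine norm_integral_le_of_norm_le ?_ (Eventually.of_forall fun x => ?_)
  · exact ((h.integrable_comp h.continuous_rhs h.rhs_zero).abs).const_mul _
  · rw [← mul_sub, norm_mul, Real.norm_eq_abs, Real.norm_eq_abs, mul_comm]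
    gcongr
    exact abs_softTrunc_sub_le hε (h.nonneg _)

theorem tendsto_integral_softTrunc (h : IsExtendedSolution Ω f u) {ε : ℕ → ℝ}
    (hε : ∀ n, 0 < ε n) (hlim : Tendsto ε atTop (𝓝 0)) {T : E4 → E4} (hT : Continuous T) :
    Tendsto (fun n => ∫ x, f (u x) * softTrunc (ε n) (u (T x))) atTop
      (𝓝 (∫ x, f (u x) * u (T x))) := by
  rw [tendsto_iff_norm_sub_tendsto_zero]
  refine squeeze_zero (fun _ => norm_nonneg _)
    (fun n => h.abs_integral_softTrunc_sub_le (hε n) hT) ?_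
  simpa using (hlim.const_mul 2).mul_const (∫ x, |f (u x)|)

/-- Fatou's lemma applied to the energies weighted by `softTruncDeriv`, as ε → 0. It yields only an
inequality, which suffices because the energy later enters an upper bound with a positive
coefficient. -/
theorem lintegral_sq_le (h : IsExtendedSolution Ω f u) :
    ∫⁻ x, ENNReal.ofReal (‖innerGradient Ω u x‖ ^ 2) ≤
      ENNReal.ofReal (∫ x, f (u x) * u x) := by
  set ε : ℕ → ℝ := fun n => 1 / ((n : ℝ) + 1)
  have hε : ∀ n, 0 < ε n := fun n => Nat.one_div_pos_of_nat
  have hlim : Tendsto ε atTop (𝓝 0) := tendsto_one_div_add_atTop_nhds_zero_nat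
  have hm := h.measurable_innerGradient
  have h1 : ∀ x, ENNReal.ofReal (‖innerGradient Ω u x‖ ^ 2) =
      liminf (fun n => ENNReal.ofReal (softTruncDeriv (ε n) (u x) * ‖innerGradient Ω u x‖ ^ 2))
        atTop := by
    intro x
    refine (Tendsto.liminf_eq ?_).symm
    by_cases hx : x ∈ Ω
    · have := (tendsto_softTruncDeriv (h.pos x hx) hlim).mul_const (‖innerGradient Ω u x‖ ^ 2)
      rw [one_mul] at this
      exact (ENNReal.continuous_ofReal.tendsto _).comp this
    · simp [innerGradient, indicator_of_notMem hx]
  have h2 : ∀ n, ∫⁻ x, ENNReal.ofReal (softTruncDeriv (ε n) (u x) * ‖innerGradient Ω u x‖ ^ 2) =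
      ENNReal.ofReal (∫ x, f (u x) * softTrunc (ε n) (u x)) := by
    intro n
    obtain ⟨hi, he⟩ := h.integrable_deriv_mul_sq (hε n) (hasDerivAt_softTrunc (hε n))
      (continuous_softTruncDeriv (hε n)) (fun s hs => softTrunc_of_le (hε n) hs)
    rw [← he, ofReal_integral_eq_lintegral_ofReal hi (Eventually.of_forall fun x =>
      mul_nonneg (softTruncDeriv_nonneg _ _) (sq_nonneg _))]
  simp_rw [h1]
  refine (lintegral_liminf_le fun n => ?_).trans ?_
  · exact (((continuous_softTruncDeriv (hε n)).measurable.comp h.continuous.measurable).mul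
      (hm.norm.pow_const 2)).ennreal_ofReal
  · simp_rw [h2]
    exact ((ENNReal.continuous_ofReal.tendsto _).comp
      (h.tendsto_integral_softTrunc hε hlim continuous_id)).liminf_eq.le

theorem integrable_sq (h : IsExtendedSolution Ω f u) :
    Integrable fun x => ‖innerGradient Ω u x‖ ^ 2 := by
  refine ⟨(h.measurable_innerGradient.norm.pow_const 2).aestronglyMeasurable, ?_⟩
  rw [hasFiniteIntegral_iff_ofReal (Eventually.of_forall fun x => sq_nonneg _)]
  exact h.lintegral_sq_le.trans_lt ENNReal.ofReal_lt_top

theorem integral_mul_self_nonneg (h : IsExtendedSolution Ω f u) :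
    0 ≤ ∫ x, f (u x) * u x := by
  set ε : ℕ → ℝ := fun n => 1 / ((n : ℝ) + 1)
  have hε : ∀ n, 0 < ε n := fun n => Nat.one_div_pos_of_nat
  refine ge_of_tendsto' (h.tendsto_integral_softTrunc hε
    tendsto_one_div_add_atTop_nhds_zero_nat continuous_id) fun n => ?_
  have := (h.integrable_deriv_mul_sq (hε n) (hasDerivAt_softTrunc (hε n))
      (continuous_softTruncDeriv (hε n)) (fun s hs => softTrunc_of_le (hε n) hs)).2
  change 0 ≤ ∫ x, f (u x) * softTrunc (ε n) (u x)
  rw [← this]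
  exact integral_nonneg fun x => mul_nonneg (softTruncDeriv_nonneg _ _) (sq_nonneg _)

/-- The energy inequality. -/
theorem integral_sq_le (h : IsExtendedSolution Ω f u) :
    ∫ x, ‖innerGradient Ω u x‖ ^ 2 ≤ ∫ x, f (u x) * u x := by
  have := h.lintegral_sq_le
  rwa [← ofReal_integral_eq_lintegral_ofReal h.integrable_sq (Eventually.of_forall fun x =>
      sq_nonneg _), ENNReal.ofReal_le_ofReal_iff h.integral_mul_self_nonneg] at this

end IsExtendedSolution

/-- Weak `L²` bound of a solution by the `L¹` norm of its right-hand side. -/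
theorem exists_weak_type_const : ∃ C : ℝ, 0 < C ∧ ∀ (Ω : Set E4) (f : ℝ → ℝ) (u : E4 → ℝ),
    IsExtendedSolution Ω f u → ∀ k : ℝ, 0 < k →
      volume {x | k ≤ u x} ≤ ENNReal.ofReal (C * (∫ x, |f (u x)|) ^ 2 / k ^ 2) := by
  obtain ⟨S, hS, hsob⟩ := exists_sobolev_const
  refine ⟨625 * (S + 1), by positivity, fun Ω f u h k hk => ?_⟩
  obtain ⟨ht, hg⟩ := h.isTestFunction_comp (half_pos hk) (hasDerivAt_softCap hk)
    (continuous_softCapDeriv k) (fun s hs => softCap_of_le hk hs)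
  obtain ⟨hi, he⟩ := h.integrable_deriv_mul_sq (half_pos hk) (hasDerivAt_softCap hk)
    (continuous_softCapDeriv k) (fun s hs => softCap_of_le hk hs)
  set I := ∫ x, |f (u x)|
  have hI : 0 ≤ I := integral_nonneg fun x => abs_nonneg _
  -- Since 0 ≤ ψ' ≤ 1 for ψ = `softCap k`, (ψ')² ≤ ψ'; testing with ψ(u) ≤ k then brings in the L¹
  -- norm of the right-hand side.
  have hgrad : ∫ x, ‖gradient (fun x => softCap k (u x)) x‖ ^ 2 ≤ k * I := by
    calc ∫ x, ‖gradient (fun x => softCap k (u x)) x‖ ^ 2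
        ≤ ∫ x, softCapDeriv k (u x) * ‖innerGradient Ω u x‖ ^ 2 := by
          refine integral_mono_of_nonneg (Eventually.of_forall fun x => sq_nonneg _) hi
            (Eventually.of_forall fun x => ?_)
          have h0 := softCapDeriv_nonneg k (u x)
          have h1 := softCapDeriv_le_one k (u x)
          simp only [hg, norm_smul, mul_pow, Real.norm_eq_abs, sq_abs]
          refine mul_le_mul_of_nonneg_right ?_ (sq_nonneg _)
          nlinarith
      _ = ∫ x, f (u x) * softCap k (u x) := he
      _ ≤ ∫ x, k * |f (u x)| := by
          refine integral_mono (h.integrable_rhs_mul ht.contDiff.continuous)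
            ((h.integrable_comp h.continuous_rhs h.rhs_zero).abs.const_mul _) fun x => ?_
          have h0 := softCap_nonneg hk (u x)
          have h1 := softCap_le hk (u x)
          have h2 := le_abs_self (f (u x))
          simp only
          nlinarith [abs_nonneg (f (u x))]
      _ = k * I := integral_const_mul _ _
  have h4 : ∫ x, softCap k (u x) ^ 4 ≤ S * (k * I) ^ 2 := by
    refine (hsob _ ht.contDiff ht.hasCompactSupport).trans ?_
    gcongr
  have hcap : Continuous (softCap k) :=
    continuous_iff_continuousAt.2 fun s => (hasDerivAt_softCap hk s).continuousAt
  have hint : Integrable fun x => softCap k (u x) ^ 4 :=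
    h.integrable_comp (g := fun s => softCap k s ^ 4) (hcap.pow 4)
      (by simp [softCap_of_le hk (half_pos hk).le])
  have hms : MeasurableSet {x | k ≤ u x} :=
    (isClosed_le continuous_const h.continuous).measurableSet
  have hfin : volume {x | k ≤ u x} ≠ ⊤ := (h.isCompact_superlevel hk).measure_lt_top.ne
  -- Chebyshev against the Sobolev bound S(kI)²: k⁴ on the left and k² on the right leave the decay
  -- k⁻², and 625 = 5⁴.
  have h5 : (k / 5) ^ 4 * (volume {x | k ≤ u x}).toReal ≤ ∫ x, softCap k (u x) ^ 4 := by
    have : ∫ x in {x | k ≤ u x}, (k / 5) ^ 4 = (k / 5) ^ 4 * (volume {x | k ≤ u x}).toReal := by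
      rw [setIntegral_const, smul_eq_mul, mul_comm, measureReal_def]
    rw [← this]
    refine (setIntegral_mono_on (integrableOn_const hfin) hint.integrableOn hms
      fun x hx => ?_).trans (setIntegral_le_integral hint (Eventually.of_forall fun x => ?_))
    · exact pow_le_pow_left₀ (by positivity) (le_softCap hk hx) 4
    · have := softCap_nonneg hk (u x)
      positivity
  rw [← ENNReal.ofReal_toReal hfin]
  refine ENNReal.ofReal_le_ofReal ?_
  rw [le_div_iff₀ (by positivity)]
  have h6 := h5.trans h4
  have e1 : (k / 5) ^ 4 * (volume {x | k ≤ u x}).toReal =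
      k ^ 2 / 625 * ((volume {x | k ≤ u x}).toReal * k ^ 2) := by ring
  have e2 : S * (k * I) ^ 2 = k ^ 2 / 625 * (625 * S * I ^ 2) := by ring
  rw [e1, e2] at h6
  have h8 := le_of_mul_le_mul_left h6 (by positivity)
  linarith [sq_nonneg I, mul_add (625 * I ^ 2) S 1]

/-! ### Dilations -/

theorem integral_comp_dilation (g : E4 → ℝ) {r : ℝ} (hr : 0 < r) :
    ∫ x, g (r • x) = (r ^ 4)⁻¹ * ∫ x, g x := by
  rw [Measure.integral_comp_smul_of_nonneg volume g r (hR := hr.le)]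
  simp

theorem mem_of_smul_mem {Ω : Set E4} (hstar : StarConvex ℝ 0 Ω) {r : ℝ} (hr : 1 ≤ r) {x : E4}
    (hx : r • x ∈ Ω) : x ∈ Ω := by
  have := hstar.smul_mem hx (t := r⁻¹) (by positivity) (inv_le_one_of_one_le₀ hr)
  rwa [inv_smul_smul₀ (by positivity)] at this

theorem IsTestFunction.comp_dilation {Ω : Set E4} {φ : E4 → ℝ} (hφ : IsTestFunction Ω φ)
    (hstar : StarConvex ℝ 0 Ω) {r : ℝ} (hr : 1 ≤ r) :
    IsTestFunction Ω (fun x => φ (r • x)) ∧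
      ∀ x, gradient (fun x => φ (r • x)) x = r • gradient φ (r • x) := by
  have hr0 : r ≠ 0 := by positivity
  have hsub : tsupport (fun x => φ (r • x)) ⊆ (fun x => r • x) ⁻¹' tsupport φ := by
    refine closure_minimal (fun x hx => subset_tsupport φ hx)
      ((isClosed_tsupport φ).preimage (continuous_const_smul r))
  refine ⟨⟨?_, ?_, fun x hx => mem_of_smul_mem hstar hr (hφ.tsupport_subset (hsub hx))⟩,
    fun x => ?_⟩
  · exact hφ.contDiff.comp (contDiff_id.const_smul r)
  · exact hφ.hasCompactSupport.comp_homeomorph (Homeomorph.smulOfNeZero r hr0)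
  · rw [gradient, gradient, fderiv_comp_smul, map_smul]

namespace IsExtendedSolution

variable {Ω : Set E4} {f : ℝ → ℝ} {u : E4 → ℝ}

theorem norm_gradient_softTrunc_le (h : IsExtendedSolution Ω f u) {ε : ℝ} (hε : 0 < ε) (x : E4) :
    ‖gradient (fun x => softTrunc ε (u x)) x‖ ≤ ‖innerGradient Ω u x‖ := by
  rw [(h.isTestFunction_comp hε (hasDerivAt_softTrunc hε) (continuous_softTruncDeriv hε)
    (fun _ hs => softTrunc_of_le hε hs)).2, norm_smul, Real.norm_eq_abs,
    abs_of_nonneg (softTruncDeriv_nonneg _ _)]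
  exact mul_le_of_le_one_left (norm_nonneg _) (softTruncDeriv_le_one _ _)

theorem isTestFunction_softTrunc (h : IsExtendedSolution Ω f u) {ε : ℝ} (hε : 0 < ε) :
    IsTestFunction Ω (fun x => softTrunc ε (u x)) :=
  (h.isTestFunction_comp hε (hasDerivAt_softTrunc hε) (continuous_softTruncDeriv hε)
    (fun _ hs => softTrunc_of_le hε hs)).1

/-- The Dirichlet energy of `u` in the layer between `r⁻¹ • Ω` and `Ω`. -/
theorem integral_layer_sq_le (h : IsExtendedSolution Ω f u) (hstar : StarConvex ℝ 0 Ω) {r : ℝ}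
    (hr : 1 ≤ r) :
    ∫ x in {x | r • x ∉ Ω}, ‖innerGradient Ω u x‖ ^ 2 ≤
      (1 + (r ^ 2)⁻¹) * (∫ x, f (u x) * u x) - 2 * ∫ x, f (u x) * u (r • x) := by
  have hr0 : 0 < r := by positivity
  set ε : ℕ → ℝ := fun n => 1 / ((n : ℝ) + 1)
  have hε : ∀ n, 0 < ε n := fun n => Nat.one_div_pos_of_nat
  have hlim : Tendsto ε atTop (𝓝 0) := tendsto_one_div_add_atTop_nhds_zero_nat
  have hT : Continuous fun x : E4 => r • x := continuous_const_smul r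
  refine le_of_tendsto_of_tendsto' tendsto_const_nhds (tendsto_const_nhds.sub
    ((h.tendsto_integral_softTrunc hε hlim hT).const_mul 2)) fun n => ?_
  obtain ⟨ht, hg⟩ := (h.isTestFunction_softTrunc (hε n)).comp_dilation hstar hr
  have hms : MeasurableSet {x : E4 | r • x ∉ Ω} := (h.isOpen.preimage hT).measurableSet.compl
  have hi1 := h.integrable_sq
  have hi2 := h.integrable_inner ht
  have hi3 : Integrable fun x : E4 => ‖innerGradient Ω u (r • x)‖ ^ 2 :=
    hi1.comp_smul hr0.ne'
  have hweak := h.integral_inner_gradient ht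
  rw [← integral_indicator hms]
  -- Let w(x) be the truncation of u(rx). The square |∇u - ∇w|² is nonnegative and equals |∇u|² in
  -- the layer, where ∇w = 0. The cross term is given by the weak equation, and the energy of u(r·)
  -- is r²·r⁻⁴ times that of u.
  calc ∫ x, indicator {x | r • x ∉ Ω} (fun x => ‖innerGradient Ω u x‖ ^ 2) x
      ≤ ∫ x, (‖innerGradient Ω u x‖ ^ 2 - 2 * inner ℝ (innerGradient Ω u x)
          (gradient (fun x => softTrunc (ε n) (u (r • x))) x) +
            r ^ 2 * ‖innerGradient Ω u (r • x)‖ ^ 2) := by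
        refine integral_mono (hi1.indicator hms) ((hi1.sub (hi2.const_mul 2)).add
          (hi3.const_mul _)) fun x => ?_
        have hle := h.norm_gradient_softTrunc_le (hε n) (r • x)
        by_cases hx : r • x ∈ Ω
        · have h0 : x ∉ {x | r • x ∉ Ω} := fun h' => h' hx
          simp only [indicator_of_notMem h0]
          have h1 := norm_sub_sq_real (innerGradient Ω u x)
            (gradient (fun x => softTrunc (ε n) (u (r • x))) x)
          have h2 : ‖gradient (fun x => softTrunc (ε n) (u (r • x))) x‖ ^ 2 ≤
              r ^ 2 * ‖innerGradient Ω u (r • x)‖ ^ 2 := by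
            rw [hg, norm_smul, mul_pow, Real.norm_eq_abs, sq_abs]
            gcongr
          nlinarith [sq_nonneg ‖innerGradient Ω u x -
            gradient (fun x => softTrunc (ε n) (u (r • x))) x‖]
        · have h0 : x ∈ {x | r • x ∉ Ω} := hx
          have h1 : innerGradient Ω u (r • x) = 0 := indicator_of_notMem hx _
          rw [h1, norm_zero, norm_le_zero_iff] at hle
          simp only [indicator_of_mem h0, hg, hle, h1]
          simp
    _ = (∫ x, ‖innerGradient Ω u x‖ ^ 2) -
          2 * (∫ x, f (u x) * softTrunc (ε n) (u (r • x))) +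
          r ^ 2 * ((r ^ 4)⁻¹ * ∫ x, ‖innerGradient Ω u x‖ ^ 2) := by
        have hi12 : Integrable fun x => ‖innerGradient Ω u x‖ ^ 2 -
            2 * inner ℝ (innerGradient Ω u x)
              (gradient (fun x => softTrunc (ε n) (u (r • x))) x) := hi1.sub (hi2.const_mul 2)
        rw [integral_add hi12 (hi3.const_mul _), integral_sub hi1 (hi2.const_mul 2),
          integral_const_mul, integral_const_mul, hweak,
          integral_comp_dilation (fun x => ‖innerGradient Ω u x‖ ^ 2) hr0]
    _ = (1 + (r ^ 2)⁻¹) * (∫ x, ‖innerGradient Ω u x‖ ^ 2) -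
          2 * (∫ x, f (u x) * softTrunc (ε n) (u (r • x))) := by
        field_simp
        ring
    _ ≤ _ := by
        have := h.integral_sq_le
        gcongr

end IsExtendedSolution

/-- `L¹` continuity of dilations on compactly supported `C¹` functions. -/
theorem IsTestFunction.integral_abs_sub_dilation_le {Ω : Set E4} {v : E4 → ℝ}
    (hv : IsTestFunction Ω v) {R : ℝ} (hR0 : 0 ≤ R) (hR : ∀ x ∈ Ω, ‖x‖ ≤ R) {r : ℝ}
    (hr : 1 ≤ r) :
    ∫ x, |v x - v (r • x)| ≤ R * (r - 1) * ∫ x, ‖gradient v x‖ := by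
  have hr0 : r ≠ 0 := by positivity
  have hvc := hv.contDiff.continuous
  have hgc := hv.continuous_gradient
  have hgi : Integrable (gradient v) :=
    hgc.integrable_of_hasCompactSupport hv.hasCompactSupport_gradient
  have hI : Integrable fun x => v x - v (r • x) :=
    (hvc.integrable_of_hasCompactSupport hv.hasCompactSupport).sub
      ((hvc.integrable_of_hasCompactSupport hv.hasCompactSupport).comp_smul hr0)
  have hpt : ∀ x, ENNReal.ofReal |v x - v (r • x)| ≤
      ∫⁻ s in Ioc 1 r, ENNReal.ofReal (R * ‖gradient v (s • x)‖) := by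
    intro x
    -- The difference v(rx) - v(x) is the integral of ∇v(sx)·x over s from 1 to r. Where the
    -- integrand is nonzero, |x| ≤ |sx| ≤ R.
    have hder : ∀ s : ℝ, HasDerivAt (fun s : ℝ => v (s • x)) (inner ℝ (gradient v (s • x)) x) s := by
      intro s
      have h1 := ((hv.contDiff.differentiable (by norm_num)) (s • x)).hasFDerivAt
      have h2 : HasDerivAt (fun s : ℝ => s • x) x s := by
        simpa using (hasDerivAt_id s).smul_const x
      rw [inner_gradient_left]
      exact h1.comp_hasDerivAt s h2
    have hc : Continuous fun s : ℝ => inner ℝ (gradient v (s • x)) x := by fun_prop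
    have hftc := intervalIntegral.integral_eq_sub_of_hasDerivAt (a := 1) (b := r)
      (fun s _ => hder s) (hc.intervalIntegrable _ _)
    rw [one_smul, intervalIntegral.integral_of_le hr] at hftc
    rw [abs_sub_comm, ← hftc, ← Real.norm_eq_abs]
    refine (ENNReal.ofReal_le_ofReal (norm_integral_le_integral_norm _)).trans ?_
    rw [ofReal_integral_eq_lintegral_ofReal (hc.norm.integrableOn_Ioc)
      (Eventually.of_forall fun s => norm_nonneg _)]
    refine setLIntegral_mono (by fun_prop) fun s hs => ENNReal.ofReal_le_ofReal ?_
    refine (norm_inner_le_norm _ _).trans ?_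
    rw [mul_comm]
    by_cases hx : s • x ∈ tsupport v
    · have h1 := hR _ (hv.tsupport_subset hx)
      rw [norm_smul, Real.norm_eq_abs, abs_of_pos (by linarith [hs.1])] at h1
      have h2 : ‖x‖ ≤ R := by nlinarith [hs.1, norm_nonneg x]
      gcongr
    · rw [IsTestFunction.gradient_eq_zero hx]
      simp
  have hscale : ∀ s ∈ Ioc 1 r, ∫⁻ x, ENNReal.ofReal (R * ‖gradient v (s • x)‖) ≤
      ENNReal.ofReal (R * ∫ x, ‖gradient v x‖) := by
    intro s hs
    have hs0 : 0 < s := by linarith [hs.1]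
    rw [← ofReal_integral_eq_lintegral_ofReal
      ((hgi.norm.comp_smul hs0.ne').const_mul R)
      (Eventually.of_forall fun x => mul_nonneg hR0 (norm_nonneg _)), integral_const_mul,
      integral_comp_dilation (fun x => ‖gradient v x‖) hs0]
    refine ENNReal.ofReal_le_ofReal (mul_le_mul_of_nonneg_left ?_ hR0)
    refine mul_le_of_le_one_left (integral_nonneg fun x => norm_nonneg _)
      (inv_le_one_of_one_le₀ (one_le_pow₀ hs.1.le))
  have hnn : 0 ≤ ∫ x, ‖gradient v x‖ := integral_nonneg fun x => norm_nonneg _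
  rw [← ENNReal.ofReal_le_ofReal_iff (mul_nonneg (mul_nonneg hR0 (by linarith)) hnn),
    ofReal_integral_eq_lintegral_ofReal hI.abs (Eventually.of_forall fun x => abs_nonneg _)]
  calc ∫⁻ x, ENNReal.ofReal |v x - v (r • x)|
      ≤ ∫⁻ x, ∫⁻ s in Ioc 1 r, ENNReal.ofReal (R * ‖gradient v (s • x)‖) := lintegral_mono hpt
    _ = ∫⁻ s in Ioc 1 r, ∫⁻ x, ENNReal.ofReal (R * ‖gradient v (s • x)‖) := by
        refine lintegral_lintegral_swap (Measurable.aemeasurable ?_)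
        have : Continuous fun p : E4 × ℝ => R * ‖gradient v (p.2 • p.1)‖ :=
          continuous_const.mul (hgc.comp (continuous_snd.smul continuous_fst)).norm
        exact this.measurable.ennreal_ofReal
    _ ≤ ∫⁻ s in Ioc 1 r, ENNReal.ofReal (R * ∫ x, ‖gradient v x‖) :=
        setLIntegral_mono measurable_const hscale
    _ = ENNReal.ofReal (R * (r - 1) * ∫ x, ‖gradient v x‖) := by
        rw [setLIntegral_const, Real.volume_Ioc, ← ENNReal.ofReal_mul (by positivity)]
        congr 1
        ring

namespace IsExtendedSolution

variable {Ω : Set E4} {f : ℝ → ℝ} {u : E4 → ℝ}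

theorem integrable_norm_innerGradient (h : IsExtendedSolution Ω f u) :
    Integrable fun x => ‖innerGradient Ω u x‖ := by
  have hfin : volume Ω ≠ ⊤ := h.isBounded.measure_lt_top.ne
  have h1 : Integrable (Ω.indicator fun _ => (1 : ℝ)) :=
    (integrable_indicator_iff h.isOpen.measurableSet).2 (integrableOn_const hfin)
  refine (h1.add h.integrable_sq).mono' h.measurable_innerGradient.norm.aestronglyMeasurable
    (Eventually.of_forall fun x => ?_)
  rw [norm_norm]
  by_cases hx : x ∈ Ω
  · simp only [Pi.add_apply, indicator_of_mem hx]
    nlinarith [sq_nonneg (‖innerGradient Ω u x‖ - 1), norm_nonneg (innerGradient Ω u x)]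
  · have : innerGradient Ω u x = 0 := indicator_of_notMem hx _
    simp [this, hx]

/-- `L¹` continuity of dilations of a solution. -/
theorem integral_abs_sub_dilation_le (h : IsExtendedSolution Ω f u) (hstar : StarConvex ℝ 0 Ω)
    {R : ℝ} (hR0 : 0 ≤ R) (hR : ∀ x ∈ Ω, ‖x‖ ≤ R) {r : ℝ} (hr : 1 ≤ r) :
    ∫ x, |u x - u (r • x)| ≤ R * (r - 1) * ∫ x, ‖innerGradient Ω u x‖ := by
  have hr0 : r ≠ 0 := by positivity
  set ε : ℕ → ℝ := fun n => 1 / ((n : ℝ) + 1)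
  have hε : ∀ n, 0 < ε n := fun n => Nat.one_div_pos_of_nat
  have hlim : Tendsto ε atTop (𝓝 0) := tendsto_one_div_add_atTop_nhds_zero_nat
  have hfin : volume Ω ≠ ⊤ := h.isBounded.measure_lt_top.ne
  have hlim' : Tendsto (fun n => 4 * ε n * volume.real Ω +
      R * (r - 1) * ∫ x, ‖innerGradient Ω u x‖) atTop
      (𝓝 (R * (r - 1) * ∫ x, ‖innerGradient Ω u x‖)) := by
    simpa using ((hlim.const_mul 4).mul_const (volume.real Ω)).add_const
      (R * (r - 1) * ∫ x, ‖innerGradient Ω u x‖)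
  refine ge_of_tendsto' hlim' fun n => ?_
  have ht := h.isTestFunction_softTrunc (hε n)
  have hc := ht.contDiff.continuous
  have hi : Integrable fun x => softTrunc (ε n) (u x) :=
    hc.integrable_of_hasCompactSupport ht.hasCompactSupport
  have hI : Integrable fun x => softTrunc (ε n) (u x) - softTrunc (ε n) (u (r • x)) :=
    hi.sub (hi.comp_smul hr0)
  have h1 : Integrable (Ω.indicator fun _ => 4 * ε n) :=
    (integrable_indicator_iff h.isOpen.measurableSet).2 (integrableOn_const hfin)
  have hgi : Integrable fun x => ‖gradient (fun x => softTrunc (ε n) (u x)) x‖ :=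
    (ht.continuous_gradient.integrable_of_hasCompactSupport ht.hasCompactSupport_gradient).norm
  -- Two truncation errors of at most 2ε each, confined to Ω because both values vanish off Ω by
  -- starshapedness.
  calc ∫ x, |u x - u (r • x)|
      ≤ ∫ x, (Ω.indicator (fun _ => 4 * ε n) x +
          |softTrunc (ε n) (u x) - softTrunc (ε n) (u (r • x))|) := by
        refine integral_mono_of_nonneg (Eventually.of_forall fun x => abs_nonneg _)
          (h1.add hI.abs) (Eventually.of_forall fun x => ?_)
        by_cases hx : x ∈ Ω
        · simp only [indicator_of_mem hx]
          have h2 := abs_softTrunc_sub_le (hε n) (h.nonneg x)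
          have h3 := abs_softTrunc_sub_le (hε n) (h.nonneg (r • x))
          rw [abs_le] at h2 h3
          have h4 := le_abs_self (softTrunc (ε n) (u x) - softTrunc (ε n) (u (r • x)))
          have h5 := neg_abs_le (softTrunc (ε n) (u x) - softTrunc (ε n) (u (r • x)))
          rw [abs_le]
          constructor <;> linarith
        · have hx' : r • x ∉ Ω := fun h' => hx (mem_of_smul_mem hstar hr h')
          simp [hx, h.eq_zero x hx, h.eq_zero _ hx']
    _ = 4 * ε n * volume.real Ω +
          ∫ x, |softTrunc (ε n) (u x) - softTrunc (ε n) (u (r • x))| := by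
        rw [integral_add h1 hI.abs, integral_indicator h.isOpen.measurableSet, setIntegral_const,
          smul_eq_mul, mul_comm]
    _ ≤ 4 * ε n * volume.real Ω + R * (r - 1) * ∫ x, ‖innerGradient Ω u x‖ := by
        have h2 := ht.integral_abs_sub_dilation_le hR0 hR hr
        have h3 := integral_mono hgi h.integrable_norm_innerGradient
          (fun x => h.norm_gradient_softTrunc_le (hε n) x)
        have h4 : 0 ≤ R * (r - 1) := mul_nonneg hR0 (by linarith)
        have h5 := mul_le_mul_of_nonneg_left h3 h4
        linarith

end IsExtendedSolution

/-! ### Layer energy and the Pohozaev functional -/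

theorem mul_sub_le_integral_add {f : ℝ → ℝ} (hf : Continuous f) {a b τ : ℝ}
    (hτ : ∀ s ∈ uIcc b a, |f s - f a| ≤ τ) :
    f a * (a - b) ≤ (∫ s in 0..a, f s) - (∫ s in 0..b, f s) + τ * |a - b| := by
  have h1 : (∫ s in 0..a, f s) - (∫ s in 0..b, f s) = ∫ s in b..a, f s :=
    intervalIntegral.integral_interval_sub_left (hf.intervalIntegrable _ _)
      (hf.intervalIntegrable _ _)
  have h2 : ∫ s in b..a, (f s - f a) = (∫ s in b..a, f s) - (a - b) * f a := by
    rw [intervalIntegral.integral_sub (hf.intervalIntegrable _ _) (by simp)]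
    simp
  have h3 : ‖∫ s in b..a, (f s - f a)‖ ≤ τ * |a - b| :=
    intervalIntegral.norm_integral_le_of_norm_le_const fun s hs => hτ s (uIoc_subset_uIcc hs)
  rw [h2, Real.norm_eq_abs, abs_le] at h3
  rw [h1]
  linarith [h3.1]

theorem continuous_primitive {f : ℝ → ℝ} (hf : Continuous f) :
    Continuous fun s => ∫ t in 0..s, f t :=
  intervalIntegral.continuous_primitive (fun _ _ => hf.intervalIntegrable _ _) 0

namespace IsExtendedSolution

variable {Ω : Set E4} {f : ℝ → ℝ} {u : E4 → ℝ}

theorem integrable_primitive (h : IsExtendedSolution Ω f u) :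
    Integrable fun x => ∫ t in 0..u x, f t :=
  h.integrable_comp (g := fun s => ∫ t in 0..s, f t) (continuous_primitive h.continuous_rhs)
    (by simp)

/-- A first-order expansion of F between u(rx) and u(x). Uniform continuity of u, and of f on the
range of u, makes the error τ uniform in x, and scaling evaluates ∫F(u(rx)) dx as r⁻⁴∫F(u). -/
theorem eventually_integral_mul_sub_le (h : IsExtendedSolution Ω f u) (hstar : StarConvex ℝ 0 Ω)
    {τ : ℝ} (hτ : 0 < τ) :
    ∀ᶠ r : ℝ in 𝓝[>] 1, ∫ x, f (u x) * (u x - u (r • x)) ≤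
      (1 - (r ^ 4)⁻¹) * (∫ x, ∫ t in 0..u x, f t) + τ * ∫ x, |u x - u (r • x)| := by
  obtain ⟨M, hM⟩ := h.hasCompactSupport.exists_bound_of_continuous h.continuous
  have hfu : UniformContinuousOn f (Icc 0 M) :=
    isCompact_Icc.uniformContinuousOn_of_continuous h.continuous_rhs.continuousOn
  obtain ⟨δ, hδ, hfδ⟩ := Metric.uniformContinuousOn_iff.1 hfu τ hτ
  have huu : UniformContinuous u :=
    Continuous.uniformContinuous_of_tendsto_cocompact h.continuous
      h.hasCompactSupport.is_zero_at_infty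
  obtain ⟨δ', hδ', huδ⟩ := Metric.uniformContinuous_iff.1 huu δ hδ
  obtain ⟨R, hR0, hR⟩ := h.isBounded.exists_pos_norm_le
  have hev : ∀ᶠ r : ℝ in 𝓝[>] 1, r < 1 + δ' / (2 * R) :=
    mem_nhdsWithin_of_mem_nhds (gt_mem_nhds (by
      have : 0 < δ' / (2 * R) := by positivity
      linarith))
  filter_upwards [hev, self_mem_nhdsWithin] with r hr1 hr
  have hr : 1 < r := hr
  have hr0 : r ≠ 0 := by positivity
  have hui : Integrable u := h.continuous.integrable_of_hasCompactSupport h.hasCompactSupport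
  have hdi : Integrable fun x => u x - u (r • x) := hui.sub (hui.comp_smul hr0)
  have hmem : ∀ x, u x ∈ Icc 0 M := fun x => ⟨h.nonneg x, (le_abs_self _).trans (hM x)⟩
  have hclose : ∀ x, |u x - u (r • x)| < δ := by
    intro x
    by_cases hx : x ∈ Ω
    · refine huδ ?_
      rw [dist_eq_norm, show x - r • x = (1 - r) • x by rw [sub_smul, one_smul], norm_smul,
        Real.norm_eq_abs, abs_sub_comm, abs_of_pos (by linarith)]
      calc (r - 1) * ‖x‖ ≤ δ' / (2 * R) * R := by
            have := hR x hx
            gcongr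
            linarith
        _ = δ' / 2 := by field_simp
        _ < δ' := by linarith
    · have hx' : r • x ∉ Ω := fun h' => hx (mem_of_smul_mem hstar hr.le h')
      simpa [h.eq_zero x hx, h.eq_zero _ hx'] using hδ
  have hFi := h.integrable_primitive
  have hFi' : Integrable fun x => ∫ t in 0..u (r • x), f t := hFi.comp_smul hr0
  have hFd : Integrable fun x => (∫ t in 0..u x, f t) - ∫ t in 0..u (r • x), f t := hFi.sub hFi'
  calc ∫ x, f (u x) * (u x - u (r • x))
      ≤ ∫ x, ((∫ t in 0..u x, f t) - (∫ t in 0..u (r • x), f t) + τ * |u x - u (r • x)|) := by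
        refine integral_mono (h.integrable_rhs_mul (φ := fun x => u x - u (r • x))
          (h.continuous.sub (h.continuous.comp (continuous_const_smul r))))
          (hFd.add (hdi.abs.const_mul τ)) fun x => ?_
        refine mul_sub_le_integral_add h.continuous_rhs fun s hs => ?_
        have hs' : s ∈ Icc 0 M :=
          (ordConnected_Icc.uIcc_subset (hmem (r • x)) (hmem x)) hs
        refine (hfδ s hs' (u x) (hmem x) ?_).le
        rw [Real.dist_eq, abs_sub_comm]
        exact (abs_sub_right_of_mem_uIcc hs).trans_lt (hclose x)
    _ = (1 - (r ^ 4)⁻¹) * (∫ x, ∫ t in 0..u x, f t) + τ * ∫ x, |u x - u (r • x)| := by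
        rw [integral_add hFd (hdi.abs.const_mul τ), integral_sub hFi hFi', integral_const_mul,
          integral_comp_dilation (fun x => ∫ t in 0..u x, f t) (by positivity)]
        ring

/-- The energy of `u` in thin layers is controlled by the Pohozaev functional. -/
theorem eventually_integral_layer_sq_le (h : IsExtendedSolution Ω f u)
    (hstar : StarConvex ℝ 0 Ω) {τ : ℝ} (hτ : 0 < τ) :
    ∀ᶠ r : ℝ in 𝓝[>] 1, ∫ x in {x | r • x ∉ Ω}, ‖innerGradient Ω u x‖ ^ 2 ≤
      (r - 1) * (2 * (4 * (∫ x, ∫ t in 0..u x, f t) - ∫ x, f (u x) * u x) + τ) := by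
  obtain ⟨R, hR0, hR⟩ := h.isBounded.exists_pos_norm_le
  set a := ∫ x, f (u x) * u x
  set b := ∫ x, ∫ t in 0..u x, f t
  set K := R * ∫ x, ‖innerGradient Ω u x‖
  have hK : 0 ≤ K := mul_nonneg hR0.le (integral_nonneg fun x => norm_nonneg _)
  have hτ' : 0 < τ / (4 * (K + 1)) := by positivity
  -- Up to the τ-error, this function of r bounds the layer energy. It vanishes at r = 1, and its
  -- derivative there is twice the Pohozaev functional 4b - a.
  have hder : HasDerivAt (fun r : ℝ => ((r ^ 2)⁻¹ - 1) * a + 2 * (1 - (r ^ 4)⁻¹) * b)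
      (-2 * a + 8 * b) 1 := by
    have h2 := ((hasDerivAt_pow 2 (1 : ℝ)).inv (by norm_num)).sub_const 1 |>.mul_const a
    have h4 := (((hasDerivAt_pow 4 (1 : ℝ)).inv (by norm_num)).const_sub 1).const_mul 2
      |>.mul_const b
    refine (h2.add h4).congr_deriv ?_
    norm_num
  have hslope := (hasDerivAt_iff_tendsto_slope.1 hder).mono_left
    (nhdsWithin_mono 1 (fun r (hr : 1 < r) => hr.ne'))
  have hev : ∀ᶠ r in 𝓝[>] (1 : ℝ), slope (fun r : ℝ => ((r ^ 2)⁻¹ - 1) * a +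
      2 * (1 - (r ^ 4)⁻¹) * b) 1 r < -2 * a + 8 * b + τ / 2 :=
    hslope.eventually_lt_const (by linarith)
  filter_upwards [hev, h.eventually_integral_mul_sub_le hstar hτ', self_mem_nhdsWithin]
    with r h1 h2 hr
  have hr : 1 < r := hr
  have h3 := h.integral_layer_sq_le hstar hr.le
  have h4 := h.integral_abs_sub_dilation_le hstar hR0.le hR hr.le
  rw [slope_def_field] at h1
  simp only [one_pow, inv_one, sub_self, zero_mul, mul_zero, add_zero, sub_zero] at h1
  rw [div_lt_iff₀ (by linarith)] at h1
  have h5 : ∫ x, f (u x) * (u x - u (r • x)) = a - ∫ x, f (u x) * u (r • x) := by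
    rw [← integral_sub (h.integrable_rhs_mul h.continuous) (h.integrable_rhs_mul
      (φ := fun x => u (r • x)) (h.continuous.comp (continuous_const_smul r)))]
    simp only [mul_sub]
  have h6 : τ / (4 * (K + 1)) * ∫ x, |u x - u (r • x)| ≤ (r - 1) * (τ / 4) := by
    calc τ / (4 * (K + 1)) * ∫ x, |u x - u (r • x)|
        ≤ τ / (4 * (K + 1)) * ((r - 1) * (K + 1)) := by
          gcongr
          refine h4.trans ?_
          have : R * (r - 1) * ∫ x, ‖innerGradient Ω u x‖ = (r - 1) * K := by ring
          rw [this]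
          nlinarith
      _ = (r - 1) * (τ / 4) := by field_simp
  rw [h5] at h2
  linarith

end IsExtendedSolution

/-! ### Strictly starshaped domains -/

/-- Near every point of its closure, a strictly starshaped smooth domain contains quantitative
neighbourhoods of slightly contracted points. -/
theorem exists_ball_subset_near {N : ℕ} {Ω : Set (EuclideanSpace ℝ (Fin N))}
    (hΩ : IsSmoothBoundedDomain Ω) (hstar : IsStrictlyStarshaped Ω)
    {y : EuclideanSpace ℝ (Fin N)} (hy : y ∈ closure Ω) :
    ∃ V ∈ 𝓝 y, ∃ s₀ > 0, ∃ k > 0, ∀ z ∈ V ∩ closure Ω, ∀ s : ℝ, 0 < s → s < s₀ →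
      ∀ e : EuclideanSpace ℝ (Fin N), ‖e‖ < k → (1 - s) • z + s • e ∈ Ω := by
  obtain ⟨R, hR, hmain⟩ : ∃ R > 0, ∀ z ∈ Metric.ball y R ∩ closure Ω, ∀ s : ℝ, 0 < s →
      ∀ e : EuclideanSpace ℝ (Fin N), ‖e‖ < R → (1 - s) • z + s • e ∈ Metric.ball y R →
        (1 - s) • z + s • e ∈ Ω := by
    by_cases hyΩ : y ∈ Ω
    · obtain ⟨R, hR, hsub⟩ := Metric.isOpen_iff.1 hΩ.isOpen y hyΩ
      exact ⟨R, hR, fun z _ s _ e _ h => hsub h⟩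
    · have hfr : y ∈ frontier Ω := by
        rw [hΩ.isOpen.frontier_eq]
        exact ⟨hy, hyΩ⟩
      obtain ⟨ρ, hρ⟩ := hΩ.smooth_boundary y hfr
      obtain ⟨hρd, hρg, U, hU, hρU⟩ := hρ
      obtain ⟨c, hc, hcν⟩ := hstar.2
      -- This is y·ν(y) > 0 up to the positive factor |∇ρ(y)|.
      have h1 : 0 < fderiv ℝ ρ y y := by
        have := hcν y hfr _ ⟨ρ, ⟨hρd, hρg, U, hU, hρU⟩, rfl⟩
        rw [inner_smul_right, inner_gradient_right] at this
        have h2 : 0 < ‖gradient ρ y‖⁻¹ * fderiv ℝ ρ y y := lt_of_lt_of_le hc (by simpa using this)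
        exact pos_of_mul_pos_right h2 (by positivity)
      have hcont : Continuous fun p : (EuclideanSpace ℝ (Fin N) × EuclideanSpace ℝ (Fin N)) ×
          EuclideanSpace ℝ (Fin N) => fderiv ℝ ρ p.1.1 (p.2 - p.1.2) := by
        have := hρd.continuous_fderiv (by simp)
        fun_prop
      -- The sign of ∇ρ(ξ)·(e - z) is stable for ξ and z near y and e near 0. The mean value theorem
      -- along the displacement s(e - z) then makes ρ strictly decrease.
      have hev : ∀ᶠ p in 𝓝 ((y, y), (0 : EuclideanSpace ℝ (Fin N))),
          fderiv ℝ ρ p.1.1 (p.2 - p.1.2) < 0 := by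
        refine hcont.continuousAt.eventually_lt continuousAt_const ?_
        simpa using h1
      obtain ⟨R₁, hR₁, hball⟩ := Metric.eventually_nhds_iff.1 hev
      obtain ⟨R₂, hR₂, hsub⟩ := Metric.mem_nhds_iff.1 hU
      refine ⟨min R₁ R₂, lt_min hR₁ hR₂, fun z hz s hs e he hw => ?_⟩
      have hB : Metric.ball y (min R₁ R₂) ⊆ U :=
        (Metric.ball_subset_ball (min_le_right _ _)).trans hsub
      rw [hρU _ (hB hw)]
      have hρz : ρ z ≤ 0 := by
        by_contra hpos
        rw [not_le] at hpos
        have hW : {x | 0 < ρ x} ∩ Metric.ball y (min R₁ R₂) ∈ 𝓝 z :=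
          ((isOpen_lt continuous_const hρd.continuous).inter Metric.isOpen_ball).mem_nhds
            ⟨hpos, hz.1⟩
        obtain ⟨x, ⟨hx1, hx2⟩, hx3⟩ := mem_closure_iff_nhds.1 hz.2 _ hW
        exact lt_asymm hx1 ((hρU x (hB hx2)).1 hx3)
      obtain ⟨ξ, hξ, heq⟩ := domain_mvt (f := ρ) (f' := fderiv ℝ ρ)
        (s := Metric.ball y (min R₁ R₂))
        (fun x _ => (hρd.differentiable (by simp) x).hasFDerivAt.hasFDerivWithinAt)
        (convex_ball _ _) hz.1 hw
      have hξb := (convex_ball y (min R₁ R₂)).segment_subset hz.1 hw hξ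
      have hneg : fderiv ℝ ρ ξ (e - z) < 0 := by
        refine hball (y := ((ξ, z), e)) ?_
        simp only [Prod.dist_eq, max_lt_iff, dist_zero_right]
        exact ⟨⟨lt_of_lt_of_le hξb (min_le_left _ _), lt_of_lt_of_le hz.1 (min_le_left _ _)⟩,
          lt_of_lt_of_le he (min_le_left _ _)⟩
      rw [show (1 - s) • z + s • e - z = s • (e - z) by module, map_smul, smul_eq_mul] at heq
      nlinarith [mul_neg_of_pos_of_neg hs hneg]
  have hcont : Continuous fun p : (EuclideanSpace ℝ (Fin N) × ℝ) × EuclideanSpace ℝ (Fin N) =>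
      (1 - p.1.2) • p.1.1 + p.1.2 • p.2 := by fun_prop
  have hev : ∀ᶠ p in 𝓝 ((y, (0 : ℝ)), (0 : EuclideanSpace ℝ (Fin N))),
      (1 - p.1.2) • p.1.1 + p.1.2 • p.2 ∈ Metric.ball y R := by
    refine hcont.continuousAt.eventually (Metric.isOpen_ball.mem_nhds ?_)
    simpa using hR
  obtain ⟨δ, hδ, hball⟩ := Metric.eventually_nhds_iff.1 hev
  refine ⟨Metric.ball y (min δ R), Metric.ball_mem_nhds _ (lt_min hδ hR), δ, hδ, min δ R,
    lt_min hδ hR, fun z hz s hs hsδ e he => ?_⟩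
  refine hmain z ⟨Metric.ball_subset_ball (min_le_right _ _) hz.1, hz.2⟩ s hs e
    (lt_of_lt_of_le he (min_le_right _ _)) (hball (y := ((z, s), e)) ?_)
  simp only [Prod.dist_eq, max_lt_iff, dist_zero_right]
  refine ⟨⟨lt_of_lt_of_le hz.1 (min_le_left _ _), ?_⟩, lt_of_lt_of_le he (min_le_left _ _)⟩
  rwa [Real.norm_eq_abs, abs_of_pos hs]

/-- Contracting a strictly starshaped smooth domain moves it into the interior at linear speed. -/
theorem exists_contraction_subset {N : ℕ} {Ω : Set (EuclideanSpace ℝ (Fin N))}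
    (hΩ : IsSmoothBoundedDomain Ω) (hstar : IsStrictlyStarshaped Ω) :
    ∃ s₀ > 0, ∃ k > 0, ∀ z ∈ closure Ω, ∀ s : ℝ, 0 < s → s < s₀ →
      ∀ e : EuclideanSpace ℝ (Fin N), ‖e‖ < k → (1 - s) • z + s • e ∈ Ω := by
  refine hΩ.isBounded.isCompact_closure.induction_on (p := fun S => ∃ s₀ > 0, ∃ k > 0, ∀ z ∈ S,
    ∀ s : ℝ, 0 < s → s < s₀ → ∀ e : EuclideanSpace ℝ (Fin N), ‖e‖ < k →
      (1 - s) • z + s • e ∈ Ω) ?_ ?_ ?_ ?_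
  · exact ⟨1, one_pos, 1, one_pos, by simp⟩
  · rintro S T hST ⟨s₀, hs₀, k, hk, h⟩
    exact ⟨s₀, hs₀, k, hk, fun z hz => h z (hST hz)⟩
  · rintro S T ⟨s₁, hs₁, k₁, hk₁, h₁⟩ ⟨s₂, hs₂, k₂, hk₂, h₂⟩
    refine ⟨min s₁ s₂, lt_min hs₁ hs₂, min k₁ k₂, lt_min hk₁ hk₂, ?_⟩
    rintro z (hz | hz) s hs hs' e he
    · exact h₁ z hz s hs (lt_min_iff.1 hs').1 e (lt_min_iff.1 he).1
    · exact h₂ z hz s hs (lt_min_iff.1 hs').2 e (lt_min_iff.1 he).2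
  · intro y hy
    obtain ⟨V, hV, h⟩ := exists_ball_subset_near hΩ hstar hy
    exact ⟨V ∩ closure Ω, inter_mem (mem_nhdsWithin_of_mem_nhds hV) self_mem_nhdsWithin, h⟩

/-! ### Smooth cut-off functions -/

/-- Take a piecewise linear function of the distance to K, equal to 1 up to distance δ and to 0
beyond 2δ, and mollify it at scale δ. Averaging keeps the Lipschitz constant δ⁻¹ and moves the two
thresholds to 0 and 3δ. -/
theorem exists_contDiff_cutoff {K : Set E4} {δ : ℝ} (hδ : 0 < δ) :
    ∃ η : E4 → ℝ, ContDiff ℝ 1 η ∧ (∀ x, 0 ≤ η x ∧ η x ≤ 1) ∧ (∀ x ∈ K, η x = 1) ∧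
      (∀ x, 3 * δ ≤ Metric.infDist x K → η x = 0) ∧ ∀ x, ‖gradient η x‖ ≤ δ⁻¹ := by
  set h : E4 → ℝ := fun x => max 0 (min 1 (2 - δ⁻¹ * Metric.infDist x K))
  have hlip : ∀ x y, |h x - h y| ≤ δ⁻¹ * dist x y := by
    intro x y
    have h1 := abs_max_sub_max_le_max (0 : ℝ) (min 1 (2 - δ⁻¹ * Metric.infDist x K)) 0
      (min 1 (2 - δ⁻¹ * Metric.infDist y K))
    have h2 := abs_min_sub_min_le_max (1 : ℝ) (2 - δ⁻¹ * Metric.infDist x K) 1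
      (2 - δ⁻¹ * Metric.infDist y K)
    rw [sub_self, abs_zero] at h1 h2
    refine ((h1.trans_eq (max_eq_right (abs_nonneg _))).trans
      (h2.trans_eq (max_eq_right (abs_nonneg _)))).trans ?_
    have h3 := (Metric.lipschitz_infDist_pt K).dist_le_mul x y
    rw [Real.dist_eq, NNReal.coe_one, one_mul] at h3
    rw [show 2 - δ⁻¹ * Metric.infDist x K - (2 - δ⁻¹ * Metric.infDist y K) =
      -(δ⁻¹ * (Metric.infDist x K - Metric.infDist y K)) by ring, abs_neg, abs_mul,
      abs_of_pos (inv_pos.2 hδ)]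
    gcongr
  have hcont : Continuous h := by
    have := Metric.continuous_infDist_pt K
    fun_prop
  have h01 : ∀ x, 0 ≤ h x ∧ h x ≤ 1 := fun x =>
    ⟨le_max_left _ _, max_le zero_le_one (min_le_left _ _)⟩
  set φ : ContDiffBump (0 : E4) := ⟨δ / 2, δ, by positivity, by linarith⟩
  set η : E4 → ℝ := fun x => ∫ t, φ.normed volume t * h (x - t)
  have hηc : η = convolution (φ.normed volume) h (ContinuousLinearMap.lsmul ℝ ℝ) volume := by
    ext x
    simp [η, convolution]
  have hint : ∀ x, Integrable fun t => φ.normed volume t * h (x - t) := fun x =>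
    (φ.continuous_normed.mul (hcont.comp (by fun_prop))).integrable_of_hasCompactSupport
      φ.hasCompactSupport_normed.mul_right
  have hdiff : ContDiff ℝ 1 η := by
    rw [hηc]
    exact φ.hasCompactSupport_normed.contDiff_convolution_left _ φ.contDiff_normed
      hcont.locallyIntegrable
  have hone : ∀ x, (∀ y ∈ Metric.ball x δ, h y = h x) → η x = h x := by
    intro x hx
    rw [hηc]
    exact φ.normed_convolution_eq_right hx
  refine ⟨η, hdiff, fun x => ⟨?_, ?_⟩, fun x hx => ?_, fun x hx => ?_, fun x => ?_⟩
  · exact integral_nonneg fun t => mul_nonneg (φ.nonneg_normed t) (h01 _).1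
  · rw [← φ.integral_normed (μ := volume)]
    exact integral_mono (hint x) φ.integrable_normed fun t =>
      mul_le_of_le_one_right (φ.nonneg_normed t) (h01 _).2
  · have hh : ∀ y ∈ Metric.ball x δ, h y = 1 := by
      intro y hy
      have h1 : Metric.infDist y K ≤ δ :=
        (Metric.infDist_le_dist_of_mem hx).trans (le_of_lt hy)
      have h2 : δ⁻¹ * Metric.infDist y K ≤ 1 := by
        rw [inv_mul_le_iff₀ hδ, mul_one]
        exact h1
      simp only [h]
      rw [min_eq_left (by linarith), max_eq_right zero_le_one]
    have hx1 := hh x (Metric.mem_ball_self hδ)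
    rw [hone x fun y hy => by rw [hh y hy, hx1], hx1]
  · have hh : ∀ y ∈ Metric.ball x δ, h y = 0 := by
      intro y hy
      have h1 := Metric.infDist_le_infDist_add_dist (s := K) (x := x) (y := y)
      rw [Metric.mem_ball, dist_comm] at hy
      have h2 : 2 ≤ δ⁻¹ * Metric.infDist y K := by
        rw [le_inv_mul_iff₀ hδ]
        linarith
      simp only [h]
      rw [max_eq_left]
      exact (min_le_right _ _).trans (by linarith)
    have hx1 := hh x (Metric.mem_ball_self hδ)
    rw [hone x fun y hy => by rw [hh y hy, hx1], hx1]
  · rw [gradient, LinearIsometryEquiv.norm_map]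
    have hL : LipschitzWith ⟨δ⁻¹, by positivity⟩ η := by
      refine LipschitzWith.of_dist_le_mul fun x y => ?_
      rw [Real.dist_eq]
      simp only [η]
      rw [← integral_sub (hint x) (hint y), ← Real.norm_eq_abs]
      calc ‖∫ t, (φ.normed volume t * h (x - t) - φ.normed volume t * h (y - t))‖
          ≤ ∫ t, φ.normed volume t * (δ⁻¹ * dist x y) := by
            refine norm_integral_le_of_norm_le (φ.integrable_normed.mul_const _)
              (Eventually.of_forall fun t => ?_)
            rw [← mul_sub, norm_mul, Real.norm_eq_abs, Real.norm_eq_abs,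
              abs_of_nonneg (φ.nonneg_normed t)]
            refine mul_le_mul_of_nonneg_left ?_ (φ.nonneg_normed t)
            simpa using hlip (x - t) (y - t)
        _ = δ⁻¹ * dist x y := by
            rw [integral_mul_const, φ.integral_normed, one_mul]
    exact norm_fderiv_le_of_lipschitz ℝ hL

/-- Cut-off functions equal to `1` on `r⁻¹ • Ω`, supported in `Ω`, with gradient of order
`(r - 1)⁻¹`. -/
theorem exists_layer_cutoff {Ω : Set E4} (hΩ : IsSmoothBoundedDomain Ω)
    (hstar : IsStrictlyStarshaped Ω) :
    ∃ C : ℝ, 0 < C ∧ ∀ᶠ r : ℝ in 𝓝[>] 1, ∃ η : E4 → ℝ, IsTestFunction Ω η ∧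
      (∀ x, 0 ≤ η x ∧ η x ≤ 1) ∧ (∀ x, r • x ∈ Ω → η x = 1) ∧
        ∀ x, ‖gradient η x‖ ≤ C / (r - 1) := by
  obtain ⟨s₀, hs₀, k, hk, hsub⟩ := exists_contraction_subset hΩ hstar
  refine ⟨8 / k, by positivity, ?_⟩
  have hev : ∀ᶠ r : ℝ in 𝓝[>] 1, r < 1 + s₀ :=
    mem_nhdsWithin_of_mem_nhds (gt_mem_nhds (by linarith))
  have hev2 : ∀ᶠ r : ℝ in 𝓝[>] 1, r < 2 :=
    mem_nhdsWithin_of_mem_nhds (gt_mem_nhds (by norm_num))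
  filter_upwards [hev, hev2, self_mem_nhdsWithin] with r hr1 hr2 hr
  have hr : 1 < r := hr
  have hr0 : 0 < r := by linarith
  set s : ℝ := (r - 1) / r
  have hs : 0 < s := div_pos (by linarith) hr0
  have hs1 : 1 - s = r⁻¹ := by
    simp only [s]
    field_simp
    ring
  have hss : s < s₀ := by
    rw [div_lt_iff₀ hr0]
    nlinarith
  set K : Set E4 := (fun z => r⁻¹ • z) '' closure Ω
  have hK : K.Nonempty := hΩ.isConnected.nonempty.closure.image _
  -- The cut-off vanishes beyond distance 3ks/4 < ks from K, and the open ks-neighbourhood of K lies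
  -- in Ω. Since s = (r-1)/r and r < 2, the gradient bound 4/(ks) is at most 8/(k(r-1)).
  have hδ : 0 < k * s / 4 := by positivity
  obtain ⟨η, h1, h2, h3, h4, h5⟩ := exists_contDiff_cutoff (K := K) hδ
  have hts : tsupport η ⊆ Ω := by
    intro x hx
    have hx' : Metric.infDist x K ≤ 3 * (k * s / 4) := by
      refine closure_minimal (fun y hy => ?_)
        (isClosed_le (Metric.continuous_infDist_pt K) continuous_const) hx
      by_contra hlt
      exact hy (h4 y (not_le.1 hlt).le)
    have hx2 : Metric.infDist x K < k * s := by nlinarith [mul_pos hk hs]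
    obtain ⟨y, ⟨z, hz, rfl⟩, hd⟩ := (Metric.infDist_lt_iff hK).1 hx2
    have := hsub z hz s hs hss (s⁻¹ • (x - r⁻¹ • z)) (by
      rw [norm_smul, norm_inv, Real.norm_eq_abs, abs_of_pos hs, ← dist_eq_norm,
        inv_mul_lt_iff₀ hs]
      linarith)
    rwa [hs1, smul_inv_smul₀ hs.ne', add_sub_cancel] at this
  refine ⟨η, ⟨h1, ?_, hts⟩, h2, fun x hx => h3 x ⟨r • x, subset_closure hx, ?_⟩, fun x => ?_⟩
  · exact Metric.isCompact_of_isClosed_isBounded (isClosed_tsupport _) (hΩ.isBounded.subset hts)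
  · exact inv_smul_smul₀ hr0.ne' x
  · refine (h5 x).trans ?_
    have : (k * s / 4)⁻¹ = 4 * r / (k * (r - 1)) := by
      simp only [s]
      have : r - 1 ≠ 0 := by linarith
      field_simp
    rw [this, div_div, div_le_div_iff_of_pos_right (mul_pos hk (by linarith))]
    linarith

/-! ### The quantitative Pohozaev inequality -/

namespace IsExtendedSolution

variable {Ω : Set E4} {f : ℝ → ℝ} {u : E4 → ℝ}

theorem integral_layer_indicator (hΩ : IsOpen Ω) (hb : Bornology.IsBounded Ω) {r : ℝ}
    (hr : 0 < r) :
    Integrable (fun x => Ω.indicator (fun _ => (1 : ℝ)) x -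
      Ω.indicator (fun _ => (1 : ℝ)) (r • x)) ∧
    ∫ x, (Ω.indicator (fun _ => (1 : ℝ)) x - Ω.indicator (fun _ => (1 : ℝ)) (r • x)) =
      (1 - (r ^ 4)⁻¹) * volume.real Ω := by
  have h1 : Integrable (Ω.indicator fun _ => (1 : ℝ)) :=
    (integrable_indicator_iff hΩ.measurableSet).2 (integrableOn_const hb.measure_lt_top.ne)
  have h2 : Integrable fun x => Ω.indicator (fun _ => (1 : ℝ)) (r • x) := h1.comp_smul hr.ne'
  refine ⟨h1.sub h2, ?_⟩
  rw [integral_sub h1 h2, integral_comp_dilation _ hr, integral_indicator hΩ.measurableSet,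
    setIntegral_const, smul_eq_mul]
  ring

/-- Testing the equation with a cut-off function of the layer. -/
theorem abs_integral_rhs_le (h : IsExtendedSolution Ω f u) (hstar : StarConvex ℝ 0 Ω) {r : ℝ}
    (hr : 1 < r) {η : E4 → ℝ} (hη : IsTestFunction Ω η) (h01 : ∀ x, 0 ≤ η x ∧ η x ≤ 1)
    (hη1 : ∀ x, r • x ∈ Ω → η x = 1) {L M : ℝ} (hL : ∀ x, ‖gradient η x‖ ≤ L)
    (hM : ∀ x, |f (u x)| ≤ M) {τ : ℝ} (hτ : 0 < τ) :
    |∫ x, f (u x)| ≤ τ / 2 * (∫ x in {x | r • x ∉ Ω}, ‖innerGradient Ω u x‖ ^ 2) +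
      (L ^ 2 / (2 * τ) + M) * ((1 - (r ^ 4)⁻¹) * volume.real Ω) := by
  have hr0 : 0 < r := by linarith
  have hL0 : 0 ≤ L := (norm_nonneg _).trans (hL 0)
  have hM0 : 0 ≤ M := (abs_nonneg _).trans (hM 0)
  obtain ⟨hχi, hχ⟩ := integral_layer_indicator h.isOpen h.isBounded hr0
  set χ : E4 → ℝ := fun x => Ω.indicator (fun _ => (1 : ℝ)) x -
    Ω.indicator (fun _ => (1 : ℝ)) (r • x)
  have hfi : Integrable fun x => f (u x) := h.integrable_comp h.continuous_rhs h.rhs_zero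
  have hfηi : Integrable fun x => f (u x) * η x := h.integrable_rhs_mul hη.contDiff.continuous
  have hms : MeasurableSet {x : E4 | r • x ∉ Ω} :=
    (h.isOpen.preimage (continuous_const_smul r)).measurableSet.compl
  -- χ is the indicator of the layer Ω \ r⁻¹Ω, outside which f(u)(1 - η) vanishes.
  have e1 : |(∫ x, f (u x)) - ∫ x, f (u x) * η x| ≤ M * ∫ x, χ x := by
    rw [← integral_sub hfi hfηi, ← Real.norm_eq_abs, ← integral_const_mul]
    refine norm_integral_le_of_norm_le (hχi.const_mul M) (Eventually.of_forall fun x => ?_)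
    rw [Real.norm_eq_abs, show f (u x) - f (u x) * η x = f (u x) * (1 - η x) by ring, abs_mul,
      abs_of_nonneg (by linarith [(h01 x).2] : 0 ≤ 1 - η x)]
    by_cases hx : x ∈ Ω
    · by_cases hrx : r • x ∈ Ω
      · simp [χ, hx, hrx, hη1 x hrx]
      · simp only [χ, indicator_of_mem hx, indicator_of_notMem hrx]
        nlinarith [hM x, abs_nonneg (f (u x)), (h01 x).1]
    · have hrx : r • x ∉ Ω := fun h' => hx (mem_of_smul_mem hstar hr.le h')
      simp [χ, hx, hrx, h.eq_zero x hx, h.rhs_zero]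
  -- ∇η vanishes on r⁻¹Ω, so only the layer contributes; Young's inequality with weight τ splits the
  -- product ∇u·∇η.
  have e2 : |∫ x, f (u x) * η x| ≤
      τ / 2 * (∫ x in {x | r • x ∉ Ω}, ‖innerGradient Ω u x‖ ^ 2) +
        L ^ 2 / (2 * τ) * ∫ x, χ x := by
    rw [← h.integral_inner_gradient hη, ← Real.norm_eq_abs, ← integral_indicator hms,
      ← integral_const_mul, ← integral_const_mul]
    have hi1 := (h.integrable_sq.indicator hms).const_mul (τ / 2)
    have hi2 := hχi.const_mul (L ^ 2 / (2 * τ))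
    rw [← integral_add hi1 hi2]
    refine norm_integral_le_of_norm_le (hi1.add hi2) (Eventually.of_forall fun x => ?_)
    by_cases hrx : r • x ∈ Ω
    · have hx := mem_of_smul_mem hstar hr.le hrx
      have h0 : x ∉ {x : E4 | r • x ∉ Ω} := fun h' => h' hrx
      have hev : η =ᶠ[𝓝 x] fun _ => 1 := by
        filter_upwards [(h.isOpen.preimage (continuous_const_smul r)).mem_nhds hrx] with y hy
        exact hη1 y hy
      have : gradient η x = 0 := by
        rw [hev.gradient_eq, gradient_fun_const]
      simp [χ, this, h0, hx, hrx]
    · by_cases hx : x ∈ Ω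
      · have h0 : x ∈ {x : E4 | r • x ∉ Ω} := hrx
        simp only [χ, indicator_of_mem hx, indicator_of_notMem hrx, indicator_of_mem h0]
        refine (norm_inner_le_norm _ _).trans ?_
        have h3 : ‖innerGradient Ω u x‖ * ‖gradient η x‖ ≤ ‖innerGradient Ω u x‖ * L :=
          mul_le_mul_of_nonneg_left (hL x) (norm_nonneg _)
        refine h3.trans ?_
        have h4 : τ / 2 * ‖innerGradient Ω u x‖ ^ 2 + L ^ 2 / (2 * τ) * (1 - 0) -
            ‖innerGradient Ω u x‖ * L = (τ * ‖innerGradient Ω u x‖ - L) ^ 2 / (2 * τ) := by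
          field_simp
          ring
        have h5 : 0 ≤ (τ * ‖innerGradient Ω u x‖ - L) ^ 2 / (2 * τ) := by positivity
        linarith
      · have : innerGradient Ω u x = 0 := indicator_of_notMem hx _
        simp [χ, hx, hrx, this]
  rw [hχ] at e1 e2
  have e3 := abs_sub_abs_le_abs_sub (∫ x, f (u x)) (∫ x, f (u x) * η x)
  linarith

end IsExtendedSolution

/-- A quantitative Pohozaev inequality on strictly starshaped domains. -/
theorem exists_pohozaev_const {Ω : Set E4} (hΩ : IsSmoothBoundedDomain Ω)
    (hstar : IsStrictlyStarshaped Ω) :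
    ∃ κ : ℝ, 0 < κ ∧ ∀ (f : ℝ → ℝ) (u : E4 → ℝ), IsExtendedSolution Ω f u →
      κ * (∫ x, f (u x)) ^ 2 ≤
        4 * (∫ x, ∫ t in 0..u x, f t) - ∫ x, f (u x) * u x := by
  obtain ⟨C, hC, hcut⟩ := exists_layer_cutoff hΩ hstar
  set V := volume.real Ω
  have hV : 0 ≤ V := measureReal_nonneg
  set A : ℝ := 2 * C ^ 2 * V + 1
  have hA : 0 < A := by positivity
  refine ⟨(4 * A)⁻¹, by positivity, fun f u h => ?_⟩
  set P := 4 * (∫ x, ∫ t in 0..u x, f t) - ∫ x, f (u x) * u x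
  have hfc : HasCompactSupport fun x => f (u x) := h.hasCompactSupport.comp_left h.rhs_zero
  obtain ⟨M, hM⟩ := hfc.exists_bound_of_continuous (h.continuous_rhs.comp h.continuous)
  have hM0 : 0 ≤ M := (norm_nonneg _).trans (hM 0)
  -- With L = C/(r-1), Young weight σ/(r-1) and layer volume at most 4(r-1)V, all powers of r - 1
  -- cancel in the two main terms. They tend to σP and 2C²V/σ, while the M-term tends to 0.
  have key : ∀ σ : ℝ, 0 < σ → |∫ x, f (u x)| ≤ σ * P + A / σ := by
    intro σ hσ
    refine le_of_forall_pos_le_add fun ω' hω' => ?_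
    have hev : ∀ᶠ r : ℝ in 𝓝[>] 1, 4 * M * V * (r - 1) < ω' / 2 := by
      have : ContinuousAt (fun r : ℝ => 4 * M * V * (r - 1)) 1 := by fun_prop
      exact (this.mono_left nhdsWithin_le_nhds).eventually_lt_const (by simpa using half_pos hω')
    obtain ⟨r, ⟨η, hη, h01, hη1, hL⟩, hJ, hrM, hr⟩ := (hcut.and
      ((h.eventually_integral_layer_sq_le hstar.1 (τ := ω' / σ) (by positivity)).and
        (hev.and self_mem_nhdsWithin))).exists
    have hr : 1 < r := hr
    have hr1 : 0 < r - 1 := by linarith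
    have hmain := h.abs_integral_rhs_le hstar.1 hr hη h01 hη1 hL hM (τ := σ / (r - 1))
      (by positivity)
    have hvol : (1 - (r ^ 4)⁻¹) * V ≤ 4 * (r - 1) * V := by
      refine mul_le_mul_of_nonneg_right ?_ hV
      have hb := one_add_mul_le_pow (a := r⁻¹ - 1) (by
        have : 0 < r⁻¹ := by positivity
        linarith) 4
      have hrr : 2 ≤ r + r⁻¹ := by
        have : r * r⁻¹ = 1 := mul_inv_cancel₀ (by positivity)
        nlinarith [sq_nonneg (r - r⁻¹)]
      rw [add_sub_cancel, inv_pow] at hb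
      push_cast at hb
      linarith
    have h1 : σ / (r - 1) / 2 * (∫ x in {x | r • x ∉ Ω}, ‖innerGradient Ω u x‖ ^ 2) ≤
        σ * P + ω' / 2 := by
      calc _ ≤ σ / (r - 1) / 2 * ((r - 1) * (2 * P + ω' / σ)) := by gcongr
        _ = σ * P + ω' / 2 := by
          field_simp
    have h2 : ((C / (r - 1)) ^ 2 / (2 * (σ / (r - 1))) + M) * ((1 - (r ^ 4)⁻¹) * V) ≤
        A / σ + ω' / 2 := by
      calc _ ≤ ((C / (r - 1)) ^ 2 / (2 * (σ / (r - 1))) + M) * (4 * (r - 1) * V) := by gcongr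
        _ = 2 * C ^ 2 * V / σ + 4 * M * V * (r - 1) := by
          field_simp
          ring
        _ ≤ A / σ + ω' / 2 := by
          have : 2 * C ^ 2 * V / σ ≤ A / σ := by
            gcongr
            simp [A]
          linarith
    linarith
  have hP : 0 ≤ P := by
    by_contra hneg
    rw [not_le] at hneg
    -- For P < 0, the choice σ = 1 + A/(-P) makes σP + A/σ ≤ P < 0, which is absurd.
    have hq : 0 < A / -P := div_pos hA (by linarith)
    have h1 := key (1 + A / -P) (by positivity)
    have h2 : A / (1 + A / -P) ≤ A := div_le_self hA.le (by linarith)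
    have h3 : (1 + A / -P) * P = P - A := by
      have : P ≠ 0 := hneg.ne
      field_simp
      ring
    linarith [abs_nonneg (∫ x, f (u x))]
  rcases (abs_nonneg (∫ x, f (u x))).eq_or_lt with h0 | h0
  · rw [abs_eq_zero.1 h0.symm]
    simpa using hP
  -- This σ makes the term A/σ half of the left side, so it can be absorbed; what remains is
  -- |∫f(u)|² ≤ 4AP.
  · have h1 := key (2 * A / |∫ x, f (u x)|) (by positivity)
    have h2 : A / (2 * A / |∫ x, f (u x)|) = |∫ x, f (u x)| / 2 := by
      field_simp
    have h3 : |∫ x, f (u x)| ≤ 4 * A * P / |∫ x, f (u x)| := by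
      have : 2 * A / |∫ x, f (u x)| * P = 4 * A * P / |∫ x, f (u x)| / 2 := by
        ring
      linarith
    rw [le_div_iff₀ h0, ← sq, sq_abs] at h3
    rwa [inv_mul_le_iff₀ (by positivity)]

/-! ### The perturbation -/

section Perturbation

variable {p q : ℝ}

/-- A case-free product form, from which continuity across |s| = 1 is immediate. -/
theorem perturbation_eq_mul (p q s : ℝ) :
    perturbation p q s = (min |s| 1) ^ (p - 1) * (max |s| 1) ^ (q - 1) * s := by
  unfold perturbation
  split_ifs with h
  · rw [min_eq_left h.le, max_eq_right h.le, Real.one_rpow, mul_one]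
  · rw [min_eq_right (not_lt.1 h), max_eq_left (not_lt.1 h), Real.one_rpow, one_mul]

theorem continuous_perturbation (hp : 1 < p) : Continuous (perturbation p q) := by
  rw [show perturbation p q = fun s => (min |s| 1) ^ (p - 1) * (max |s| 1) ^ (q - 1) * s from
    funext (perturbation_eq_mul p q)]
  refine Continuous.mul (Continuous.mul ?_ ?_) continuous_id
  · exact (continuous_abs.min continuous_const).rpow_const fun _ => Or.inr (by linarith)
  · exact (continuous_abs.max continuous_const).rpow_const fun s =>
      Or.inl (by positivity)

theorem perturbation_of_le_one {s : ℝ} (hs : 0 ≤ s) (hs1 : s ≤ 1) (hp : 1 < p) :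
    perturbation p q s = s ^ p := by
  have h1 : s ^ (p - 1) * s = s ^ p := by
    rcases hs.eq_or_lt with rfl | h
    · rw [mul_zero, Real.zero_rpow (by linarith)]
    · rw [← Real.rpow_add_one h.ne', sub_add_cancel]
  rw [perturbation_eq_mul, abs_of_nonneg hs, min_eq_left hs1, max_eq_right hs1, Real.one_rpow,
    mul_one, h1]

theorem perturbation_of_one_le {s : ℝ} (hs1 : 1 ≤ s) : perturbation p q s = s ^ q := by
  have hs : 0 < s := by linarith
  rw [perturbation_eq_mul, abs_of_pos hs, min_eq_right hs1, max_eq_left hs1, Real.one_rpow,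
    one_mul, ← Real.rpow_add_one hs.ne', sub_add_cancel]

theorem perturbation_nonneg {s : ℝ} (hs : 0 ≤ s) : 0 ≤ perturbation p q s := by
  rw [perturbation_eq_mul]
  positivity

theorem integral_perturbation_of_le_one {s : ℝ} (hs : 0 ≤ s) (hs1 : s ≤ 1) (hp : 1 < p) :
    ∫ t in 0..s, perturbation p q t = s ^ (p + 1) / (p + 1) := by
  have : ∫ t in 0..s, perturbation p q t = ∫ t in 0..s, t ^ p := by
    refine intervalIntegral.integral_congr fun t ht => ?_
    rw [uIcc_of_le hs] at ht
    exact perturbation_of_le_one ht.1 (ht.2.trans hs1) hp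
  rw [this, integral_rpow (Or.inl (by linarith)), Real.zero_rpow (by linarith), sub_zero]

theorem integral_perturbation_of_one_le {s : ℝ} (hs1 : 1 ≤ s) (hp : 1 < p) (hq : 0 < q) :
    ∫ t in 0..s, perturbation p q t = 1 / (p + 1) + (s ^ (q + 1) - 1) / (q + 1) := by
  have hc := continuous_perturbation (q := q) hp
  rw [← intervalIntegral.integral_add_adjacent_intervals (hc.intervalIntegrable 0 1)
    (hc.intervalIntegrable 1 s), integral_perturbation_of_le_one zero_le_one le_rfl hp,
    Real.one_rpow]
  have : ∫ t in 1..s, perturbation p q t = ∫ t in 1..s, t ^ q := by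
    refine intervalIntegral.integral_congr fun t ht => ?_
    rw [uIcc_of_le hs1] at ht
    exact perturbation_of_one_le ht.1
  rw [this, integral_rpow (Or.inl (by linarith)), Real.one_rpow]

/-- Equality holds on [0,1]. Beyond 1 the growth exponent q is smaller than p, so the right side
grows faster. -/
theorem mul_perturbation_le {s : ℝ} (hs : 0 ≤ s) (hp : 1 < p) (hq : 0 < q) (hq1 : q < 1) :
    s * perturbation p q s ≤ (p + 1) * ∫ t in 0..s, perturbation p q t := by
  rcases le_total s 1 with h | h
  · rw [perturbation_of_le_one hs h hp, integral_perturbation_of_le_one hs h hp,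
      Real.rpow_add_one' hs (by linarith), mul_div_cancel₀ _ (by linarith), mul_comm]
  · have hs0 : 0 < s := by linarith
    rw [perturbation_of_one_le h, integral_perturbation_of_one_le h hp hq, mul_comm,
      ← Real.rpow_add_one hs0.ne', mul_add, mul_one_div_cancel (by linarith), ← mul_div_assoc,
      ← sub_le_iff_le_add', le_div_iff₀ (by linarith), mul_comm]
    have h1 : 1 ≤ s ^ (q + 1) := Real.one_le_rpow h (by linarith)
    exact mul_le_mul_of_nonneg_right (by linarith) (by linarith)

/-- The equality case for H ≥ 0. On [0,1], H(s) = (3-p)/(p+1)·s^(p+1). Beyond 1, H > 0 because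
4/(p+1) ≥ 1 and q + 1 < 4. -/
theorem eq_three_of_mul_perturbation_eq {s : ℝ} (hs : 0 < s) (hp : 1 < p) (hp3 : p ≤ 3)
    (hq : 0 < q) (hq1 : q < 1)
    (h : 4 * (∫ t in 0..s, perturbation p q t) - s * perturbation p q s = 0) :
    p = 3 ∧ s ≤ 1 := by
  have hs1 : s ≤ 1 := by
    by_contra hlt
    rw [not_le] at hlt
    rw [perturbation_of_one_le hlt.le, integral_perturbation_of_one_le hlt.le hp hq,
      mul_comm s, ← Real.rpow_add_one hs.ne'] at h
    have h1 : 1 < s ^ (q + 1) := Real.one_lt_rpow hlt (by linarith)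
    have h2 : 1 ≤ 4 * (1 / (p + 1)) := by
      rw [mul_one_div, le_div_iff₀ (by linarith)]
      linarith
    have h3 : s ^ (q + 1) - 1 < 4 * ((s ^ (q + 1) - 1) / (q + 1)) := by
      rw [← mul_div_assoc, lt_div_iff₀ (by linarith)]
      nlinarith
    linarith
  refine ⟨?_, hs1⟩
  rw [perturbation_of_le_one hs.le hs1 hp, integral_perturbation_of_le_one hs.le hs1 hp,
    mul_comm s, ← Real.rpow_add_one hs.ne'] at h
  have h1 : 0 < s ^ (p + 1) := Real.rpow_pos_of_pos hs _
  have h2 : s ^ (p + 1) * (3 - p) = 0 := by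
    field_simp at h
    linarith
  have := (mul_eq_zero.1 h2).resolve_left h1.ne'
  linarith

theorem lintegral_perturbation_div_sq_lt_top (hp : 1 < p) (hq1 : q < 1) :
    ∫⁻ t in Ioi (0 : ℝ), ENNReal.ofReal (perturbation p q t / t ^ 2) < ⊤ := by
  have h1 : IntegrableOn (fun t : ℝ => perturbation p q t / t ^ 2) (Ioc 0 1) := by
    have : IntegrableOn (fun t : ℝ => t ^ (p - 2)) (Ioc 0 1) :=
      (intervalIntegrable_iff_integrableOn_Ioc_of_le zero_le_one).1
        (intervalIntegral.intervalIntegrable_rpow' (by linarith))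
    refine this.congr_fun (fun t ht => ?_) measurableSet_Ioc
    simp only
    rw [perturbation_of_le_one ht.1.le ht.2 hp, Real.rpow_sub ht.1, Real.rpow_two]
  have h2 : IntegrableOn (fun t : ℝ => perturbation p q t / t ^ 2) (Ioi 1) := by
    refine (integrableOn_Ioi_rpow_of_lt (a := q - 2) (by linarith) one_pos).congr_fun
      (fun t ht => ?_) measurableSet_Ioi
    have ht : 1 < t := ht
    simp only
    rw [perturbation_of_one_le ht.le, Real.rpow_sub (by linarith), Real.rpow_two]
  have h3 := h1.union h2
  rw [Ioc_union_Ioi_eq_Ioi zero_le_one] at h3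
  exact h3.lintegral_lt_top

end Perturbation

namespace IsExtendedSolution

variable {Ω : Set E4} {f : ℝ → ℝ} {u : E4 → ℝ}

/-- Layer cake estimate from a weak `L²` bound. -/
theorem integral_primitive_perturbation_le (h : IsExtendedSolution Ω f u) {p q : ℝ} (hp : 1 < p)
    (hq1 : q < 1) {B : ℝ} (hB0 : 0 ≤ B)
    (hB : ∀ k : ℝ, 0 < k → volume {x | k ≤ u x} ≤ ENNReal.ofReal (B / k ^ 2)) :
    ∫ x, ∫ t in 0..u x, perturbation p q t ≤
      B * (∫⁻ t in Ioi (0 : ℝ), ENNReal.ofReal (perturbation p q t / t ^ 2)).toReal := by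
  have hc := continuous_perturbation (q := q) hp
  have hi : Integrable fun x => ∫ t in 0..u x, perturbation p q t :=
    h.integrable_comp (g := fun s => ∫ t in 0..s, perturbation p q t) (continuous_primitive hc)
      (by simp)
  have hnn : ∀ x, 0 ≤ ∫ t in 0..u x, perturbation p q t := fun x =>
    intervalIntegral.integral_nonneg (h.nonneg x) fun t ht => perturbation_nonneg ht.1
  rw [← ENNReal.ofReal_le_ofReal_iff (by positivity), ENNReal.ofReal_mul hB0,
    ENNReal.ofReal_toReal (lintegral_perturbation_div_sq_lt_top hp hq1).ne,
    ofReal_integral_eq_lintegral_ofReal hi (Eventually.of_forall hnn),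
    lintegral_comp_eq_lintegral_meas_le_mul volume (Eventually.of_forall h.nonneg)
      h.continuous.measurable.aemeasurable (fun t _ => hc.intervalIntegrable _ _)
      (ae_restrict_of_forall_mem measurableSet_Ioi fun t ht =>
        perturbation_nonneg (le_of_lt ht)),
    ← lintegral_const_mul' _ _ ENNReal.ofReal_ne_top]
  refine setLIntegral_mono' measurableSet_Ioi fun t ht => ?_
  have ht : 0 < t := ht
  refine (mul_le_mul_left (hB t ht) _).trans ?_
  rw [← ENNReal.ofReal_mul (by positivity), ← ENNReal.ofReal_mul hB0]
  refine ENNReal.ofReal_le_ofReal (le_of_eq ?_)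
  ring

/-- Otherwise the weak-type bound would make every superlevel set null, whereas a positive
continuous function has nonempty open ones. -/
theorem integral_abs_rhs_pos (h : IsExtendedSolution Ω f u) (hne : Ω.Nonempty) :
    0 < ∫ x, |f (u x)| := by
  refine lt_of_le_of_ne (integral_nonneg fun x => abs_nonneg _) fun h0 => ?_
  obtain ⟨C, hC, hweak⟩ := exists_weak_type_const
  obtain ⟨x₀, hx₀⟩ := hne
  have hpos := h.pos x₀ hx₀
  have h1 := hweak Ω f u h (u x₀ / 2) (by positivity)
  rw [← h0] at h1
  have h2 : volume {x | u x₀ / 2 ≤ u x} = 0 := by simpa using h1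
  have h3 : volume {x | u x₀ / 2 < u x} = 0 :=
    measure_mono_null (fun x (hx : u x₀ / 2 < u x) => hx.le) h2
  have h4 : {x | u x₀ / 2 < u x} = ∅ :=
    (isOpen_lt continuous_const h.continuous).measure_eq_zero_iff volume |>.1 h3
  have h5 : x₀ ∈ {x | u x₀ / 2 < u x} := half_lt_self hpos
  rw [h4] at h5
  exact h5

end IsExtendedSolution

theorem IsPositiveSolution.isExtendedSolution {Ω : Set E4} (hΩ : IsSmoothBoundedDomain Ω)
    {p q lam : ℝ} (hp : 1 < p) {u : E4 → ℝ}
    (h : IsPositiveSolution Ω (perturbation p q) lam u) :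
    IsExtendedSolution Ω (fun s => lam * perturbation p q s + s ^ 3) (Ω.indicator u) where
  isOpen := hΩ.isOpen
  isBounded := hΩ.isBounded
  continuous_rhs := ((continuous_perturbation hp).const_mul lam).add (continuous_pow 3)
  rhs_zero := by simp [perturbation_eq_mul]
  continuous := continuous_indicator h.boundary h.continuousOn
  eq_zero x hx := indicator_of_notMem hx u
  pos x hx := by
    rw [indicator_of_mem hx]
    exact h.pos x hx
  contDiffOn := h.contDiffOn.congr fun x hx => indicator_of_mem hx u
  equation x hx := by
    have hev : Ω.indicator u =ᶠ[𝓝 x] u := by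
      filter_upwards [hΩ.isOpen.mem_nhds hx] with y hy
      exact indicator_of_mem hy u
    have h1 := h.equation x hx
    have h2 : criticalExponent 4 - 2 = 2 := by
      norm_num [criticalExponent]
    rw [h2, Real.rpow_two, sq_abs] at h1
    rw [(InnerProductSpace.laplacian_congr_nhds hev).eq_of_nhds, indicator_of_mem hx]
    linarith

/-- The critical power drops out of the Pohozaev density: 4·s⁴/4 = s³·s. -/
theorem integral_mul_perturbation_add_cube {p q lam s : ℝ} (hp : 1 < p) :
    4 * (∫ t in 0..s, (lam * perturbation p q t + t ^ 3)) -
        (lam * perturbation p q s + s ^ 3) * s =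
      lam * (4 * (∫ t in 0..s, perturbation p q t) - s * perturbation p q s) := by
  have hc := continuous_perturbation (q := q) hp
  rw [intervalIntegral.integral_add ((hc.const_mul lam).intervalIntegrable _ _)
    ((continuous_pow 3).intervalIntegrable _ _), intervalIntegral.integral_const_mul,
    integral_pow]
  norm_num
  ring

/-! ### The lower bound for λ -/

theorem theorem2 (Ω : Set (EuclideanSpace ℝ (Fin 4)))
    (hΩ : IsSmoothBoundedDomain Ω) (hstar : IsStrictlyStarshaped Ω)
    (p q : ℝ) (hp : 1 < p) (hq0 : 0 < q) (hq1 : q < 1) :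
    ∃ lam₀ : ℝ, 0 < lam₀ ∧
      ∀ (lam : ℝ) (u : EuclideanSpace ℝ (Fin 4) → ℝ),
        IsPositiveSolution Ω (perturbation p q) lam u →
          lam₀ ≤ |lam| ∧ (0 ≤ lam ∨ p ≤ 3 → lam₀ ≤ lam) := by
  obtain ⟨κ, hκ, hpoho⟩ := exists_pohozaev_const hΩ hstar
  obtain ⟨C, hC, hweak⟩ := exists_weak_type_const
  set W := (∫⁻ t in Ioi (0 : ℝ), ENNReal.ofReal (perturbation p q t / t ^ 2)).toReal
  have hW : 0 ≤ W := ENNReal.toReal_nonneg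
  have hc := continuous_perturbation (q := q) hp
  set D := (p + 5) * (C * W) + 1
  have hD : 0 < D := by positivity
  -- κ/D serves whenever f ≥ 0 on [0,∞); the 1 serves λ ≤ -1 with p > 3. The summand 1 in D only
  -- secures positivity.
  refine ⟨min 1 (κ / D), by positivity, fun lam u₀ hu₀ => ?_⟩
  have h := hu₀.isExtendedSolution hΩ hp
  set u := Ω.indicator u₀
  have hGi : Integrable fun x => ∫ t in 0..u x, perturbation p q t :=
    h.integrable_comp (g := fun s => ∫ t in 0..s, perturbation p q t) (continuous_primitive hc)
      (by simp)
  have hGc : Continuous fun s =>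
      4 * (∫ t in 0..s, perturbation p q t) - s * perturbation p q s :=
    ((continuous_primitive hc).const_mul 4).sub (continuous_id.mul hc)
  have hHi : Integrable fun x =>
      4 * (∫ t in 0..u x, perturbation p q t) - u x * perturbation p q (u x) :=
    h.integrable_comp (g := fun s => 4 * (∫ t in 0..s, perturbation p q t) -
      s * perturbation p q s) hGc (by simp)
  have hG0 : ∀ x, 0 ≤ ∫ t in 0..u x, perturbation p q t := fun x =>
    intervalIntegral.integral_nonneg (h.nonneg x) fun t ht => perturbation_nonneg ht.1
  have hP := hpoho _ u h
  have hFi := h.integrable_primitive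
  rw [← integral_const_mul, ← integral_sub (hFi.const_mul 4)
    (h.integrable_rhs_mul h.continuous)] at hP
  simp only [integral_mul_perturbation_add_cube hp] at hP
  rw [integral_const_mul] at hP
  have hpos := h.integral_abs_rhs_pos hΩ.isConnected.nonempty
  have hlarge : (∀ s : ℝ, 0 ≤ s → 0 ≤ lam * perturbation p q s + s ^ 3) → κ / D ≤ |lam| := by
    intro hf
    have habs : ∀ x, |lam * perturbation p q (u x) + u x ^ 3| =
        lam * perturbation p q (u x) + u x ^ 3 := fun x => abs_of_nonneg (hf _ (h.nonneg x))
    simp only [habs] at hpos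
    have hG := h.integral_primitive_perturbation_le hp hq1 (by positivity) (hweak _ _ u h)
    simp only [habs] at hG
    set I := ∫ x, (lam * perturbation p q (u x) + u x ^ 3)
    -- |H| ≤ 4G + s g(s) ≤ (4 + (p+1))G, whence the factor p + 5.
    have hHb : |∫ x, (4 * (∫ t in 0..u x, perturbation p q t) -
        u x * perturbation p q (u x))| ≤ (p + 5) * (C * I ^ 2 * W) := by
      refine le_trans ?_ (mul_le_mul_of_nonneg_left hG (by linarith))
      rw [← integral_const_mul, ← Real.norm_eq_abs]
      refine norm_integral_le_of_norm_le (hGi.const_mul _) (Eventually.of_forall fun x => ?_)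
      have h1 := mul_perturbation_le (h.nonneg x) hp hq0 hq1
      have h2 := mul_nonneg (h.nonneg x) (perturbation_nonneg (p := p) (q := q) (h.nonneg x))
      have h3 := hG0 x
      have h4 : 0 ≤ p * ∫ t in 0..u x, perturbation p q t := mul_nonneg (by linarith) h3
      rw [Real.norm_eq_abs, abs_le]
      constructor <;> linarith
    have h1 : κ * I ^ 2 ≤ |lam| * ((p + 5) * (C * I ^ 2 * W)) := by
      refine hP.trans ((le_abs_self _).trans ?_)
      rw [abs_mul]
      exact mul_le_mul_of_nonneg_left hHb (abs_nonneg _)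
    rw [div_le_iff₀ hD]
    have h2 : κ * I ^ 2 ≤ (|lam| * ((p + 5) * (C * W))) * I ^ 2 := by linarith
    have h3 := le_of_mul_le_mul_right h2 (by positivity)
    have h4 : |lam| * D = |lam| * ((p + 5) * (C * W)) + |lam| := by
      simp only [D]
      ring
    linarith [abs_nonneg lam]
  rcases le_or_gt 0 lam with hlam | hlam
  · have h1 : κ / D ≤ |lam| := hlarge fun s hs =>
      add_nonneg (mul_nonneg hlam (perturbation_nonneg hs)) (pow_nonneg hs 3)
    have h2 : min 1 (κ / D) ≤ |lam| := (min_le_right _ _).trans h1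
    exact ⟨h2, fun _ => by rwa [abs_of_nonneg hlam] at h2⟩
  rcases le_or_gt p 3 with hp3 | hp3
  · exfalso
    have hH0 : ∀ x, 0 ≤ 4 * (∫ t in 0..u x, perturbation p q t) -
        u x * perturbation p q (u x) := by
      intro x
      have h1 := mul_perturbation_le (h.nonneg x) hp hq0 hq1
      have h2 := mul_le_mul_of_nonneg_right (by linarith : p + 1 ≤ 4) (hG0 x)
      linarith
    have hHnn : 0 ≤ ∫ x, (4 * (∫ t in 0..u x, perturbation p q t) -
        u x * perturbation p q (u x)) := integral_nonneg hH0
    have hI2 : 0 ≤ κ * (∫ x, (lam * perturbation p q (u x) + u x ^ 3)) ^ 2 := by positivity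
    have hHz : ∫ x, (4 * (∫ t in 0..u x, perturbation p q t) -
        u x * perturbation p q (u x)) = 0 := by
      refine le_antisymm ?_ hHnn
      by_contra hlt
      nlinarith [mul_neg_of_neg_of_pos hlam (not_le.1 hlt)]
    rw [hHz, mul_zero] at hP
    have hI0 : ∫ x, (lam * perturbation p q (u x) + u x ^ 3) = 0 := by
      by_contra hne
      have : 0 < κ * (∫ x, (lam * perturbation p q (u x) + u x ^ 3)) ^ 2 := by positivity
      linarith
    have hae := (integral_eq_zero_iff_of_nonneg hH0 hHi).1 hHz
    -- H(u) is continuous, so vanishing almost everywhere means vanishing everywhere.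
    have hall := Continuous.ae_eq_iff_eq volume (hGc.comp h.continuous) continuous_const |>.1 hae
    have hu : ∀ x ∈ Ω, p = 3 ∧ u x ≤ 1 := fun x hx =>
      eq_three_of_mul_perturbation_eq (h.pos x hx) hp hp3 hq0 hq1 (congrFun hall x)
    have hf : ∀ x, lam * perturbation p q (u x) + u x ^ 3 = (lam + 1) * u x ^ 3 := by
      intro x
      by_cases hx : x ∈ Ω
      · obtain ⟨rfl, hu1⟩ := hu x hx
        have : u x ^ (3 : ℝ) = u x ^ 3 := by exact_mod_cast Real.rpow_natCast (u x) 3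
        rw [perturbation_of_le_one (h.nonneg x) hu1 hp, this]
        ring
      · simp [h.eq_zero x hx, perturbation_eq_mul]
    have habs : ∀ x, |(lam + 1) * u x ^ 3| = |lam + 1| * u x ^ 3 := fun x => by
      rw [abs_mul, abs_of_nonneg (pow_nonneg (h.nonneg x) 3)]
    simp only [hf, habs, integral_const_mul] at hI0 hpos
    rcases mul_eq_zero.1 hI0 with h0 | h0
    · simp [h0] at hpos
    · simp [h0] at hpos
  · refine ⟨?_, fun hor => ?_⟩
    · rcases le_or_gt lam (-1) with hl | hl
      · refine (min_le_left _ _).trans ?_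
        rw [abs_of_neg hlam]
        linarith
      · refine (min_le_right _ _).trans (hlarge fun s hs => ?_)
        have hle : perturbation p q s ≤ s ^ 3 := by
          have e3 : s ^ (3 : ℝ) = s ^ 3 := by exact_mod_cast Real.rpow_natCast s 3
          rw [← e3]
          rcases le_total s 1 with h1 | h1
          · rw [perturbation_of_le_one hs h1 hp]
            exact Real.rpow_le_rpow_of_exponent_ge_of_imp hs h1 hp3.le (by intros; linarith)
          · rw [perturbation_of_one_le h1]
            exact Real.rpow_le_rpow_of_exponent_le h1 (by linarith)
        -- For -1 < λ < 0 and 0 ≤ g(s) ≤ s³, λg(s) ≥ -g(s) ≥ -s³.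
        nlinarith [perturbation_nonneg (p := p) (q := q) hs]
    · rcases hor with h0 | h0 <;> linarith
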